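/- **Model.** Two players, Al and Bob, have inputs $x,y\subseteq\{1,\dots,n\}$, and $DISJ_n(x,y)$ tells whether $x\cap y=\emptyset$. In a quantum protocol (no prior entanglement, no public coin) the players take turns; in his turn a player applies a unitary transformation, which may depend on his input, to the qubits he holds (private qubits initially in a fixed basis state, and the message just received), and then sends a prescribed number of his qubits to the other player. At the end measurements give the result to both players. The communication is the total number of qubits sent. The protocol has error $\varepsilon$ if on every input pair both players obtain the correct value with probability at least $1-\varepsilon$. **Privacy loss.** Instead of following the protocol, a player may use any sequence of quantum operations (with arbitrary additional private qubits) that is *honest*: for all inputs, every message he sends to the other player (who follows the protocol) has exactly the density matrix prescribed by the protocol. For a distribution $\mu$ of the inputs $(X,Y)$, the information divulged to such a Bob at time $t$ is $$I(B:X\mid Y,f(X,Y))=S(BYF)+S(XYF)-S(YF)-S(BXYF),\qquad F=f(X,Y),$$ where $f=DISJ_n$, $S$ is the von Neumann entropy (in bits), and $B$ consists of the qubits in Bob's hands after $t$ messages, when the inputs are distributed according to $\mu$; the information divulged to Al is defined symmetrically. The privacy loss of the protocol is the supremum of these quantities over both players, all distributions $\mu$, all times $t$ and all strategies that are honest up to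 time $t$ (so a player may quit early). **Theorem.** There is a constant $C$ such that for every $n\ge 2$ there is a quantum protocol that computes $DISJ_n$ with error $1/3$, communication at most $C\sqrt n\,\log_2 n$, and privacy loss at most $C\log_2^2 n$. -/

import Mathlib

open scoped Matrix Kronecker

noncomputable section

namespace QPrivacy

/-! ## Density matrices and entropy -/

/-- Basis labels of a register of `k` qubits. -/
abbrev Reg (k : ℕ) : Type := Fin k → Fin 2

section PartialTrace

variable {α β γ : Type} [Fintype α] [Fintype β] [Fintype γ]

/-- Trace out the first factor. -/
def trFst (ρ : Matrix (α × β) (α × β) ℂ) : Matrix β β ℂ :=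
  Matrix.of fun i j => ∑ a, ρ (a, i) (a, j)

/-- Trace out the second factor. -/
def trSnd (ρ : Matrix (α × β) (α × β) ℂ) : Matrix α α ℂ :=
  Matrix.of fun i j => ∑ b, ρ (i, b) (j, b)

/-- Trace out the middle factor. -/
def trMid (ρ : Matrix (α × β × γ) (α × β × γ) ℂ) : Matrix (α × γ) (α × γ) ℂ :=
  Matrix.of fun i j => ∑ b, ρ (i.1, b, i.2) (j.1, b, j.2)

/-- The von Neumann entropy `-∑ λ log₂ λ` over the multiset of eigenvalues (the roots of the
characteristic polynomial), in bits. -/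
def entropy [DecidableEq α] (ρ : Matrix α α ℂ) : ℝ :=
  (ρ.charpoly.roots.map fun z => -(z.re * Real.logb 2 z.re)).sum

/-- The conditional mutual information `I(R : S | C) = S(RC) + S(SC) - S(C) - S(RSC)` of a state
on `R ⊗ S ⊗ C`. -/
def condMutualInfo [DecidableEq α] [DecidableEq β] [DecidableEq γ]
    (ρ : Matrix (α × β × γ) (α × β × γ) ℂ) : ℝ :=
  entropy (trMid ρ) + entropy (trFst ρ) - entropy (trFst (trFst ρ)) - entropy ρ

end PartialTrace

/-! ## Operations -/

/-- A physically allowed operation (completely positive and trace preserving), in Kraus form. -/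
structure Channel (α β : Type) [Fintype α] [DecidableEq α] [Fintype β] where
  num : ℕ
  kraus : Fin num → Matrix β α ℂ
  complete : ∑ i, (kraus i)ᴴ * kraus i = 1

namespace Channel

variable {α β γ : Type} [Fintype α] [DecidableEq α] [Fintype β] [Fintype γ] [DecidableEq γ]

/-- Apply the operation to the first factor of a joint state. -/
def act (T : Channel α β) (ρ : Matrix (α × γ) (α × γ) ℂ) : Matrix (β × γ) (β × γ) ℂ :=
  ∑ i, (T.kraus i ⊗ₖ (1 : Matrix γ γ ℂ)) * ρ * (T.kraus i ⊗ₖ (1 : Matrix γ γ ℂ))ᴴ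

/-- The operation is `ρ ↦ V ρ Vᴴ` with `Vᴴ V = 1`. On qubit registers this is: append blank
qubits, then apply a unitary transformation. -/
def IsUnitary (T : Channel α β) : Prop := T.num = 1

end Channel

/-! ## Two-party runs -/

/-- What a player with input in `I` does in each of his turns. In turn `k` he holds `priv k`
private qubits and the `qin k` qubits of the message just received; he applies an operation, keeps
`priv (k + 1)` qubits and sends `qout k` qubits. -/
structure Strategy (I : Type) (qin qout : ℕ → ℕ) where
  priv : ℕ → ℕ
  op : (k : ℕ) → I →
    Channel (Reg (priv k) × Reg (qin k)) (Reg (priv (k + 1)) × Reg (qout k))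

/-- Hand the message over: (sender, message, receiver) becomes (receiver, message, sender). -/
def pass {P M O : Type} (ρ : Matrix ((P × M) × O) ((P × M) × O) ℂ) :
    Matrix ((O × M) × P) ((O × M) × P) ℂ :=
  ρ.submatrix (fun i => ((i.2, i.1.2), i.1.1)) (fun i => ((i.2, i.1.2), i.1.1))

section Run

variable {X Y : Type} {qA qB : ℕ → ℕ}

/-- The joint state on inputs `x, y` when each player has completed `k` turns, in the order
(Al's private qubits, Bob's last message, Bob's private qubits); the message is in Al's hands.
All qubits start in the state `|0⟩`. The `k`-th message of Al has `qA k` qubits, and the reply of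
Bob to it has `qB (k + 1)` qubits. -/
def run (A : Strategy X qB qA) (B : Strategy Y qA fun k => qB (k + 1)) (x : X) (y : Y) :
    (k : ℕ) → Matrix ((Reg (A.priv k) × Reg (qB k)) × Reg (B.priv k))
      ((Reg (A.priv k) × Reg (qB k)) × Reg (B.priv k)) ℂ
  | 0 => Matrix.single 0 0 1
  | k + 1 => pass ((B.op k y).act (pass ((A.op k x).act (run A B x y k))))

/-- The joint state when Al has completed `k + 1` turns and Bob `k` turns, in the order
(Bob's private qubits, Al's last message, Al's private qubits); the message is in Bob's hands. -/
def runMid (A : Strategy X qB qA) (B : Strategy Y qA fun k => qB (k + 1)) (x : X) (y : Y) (k : ℕ) :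
    Matrix ((Reg (B.priv k) × Reg (qA k)) × Reg (A.priv (k + 1)))
      ((Reg (B.priv k) × Reg (qA k)) × Reg (A.priv (k + 1))) ℂ :=
  pass ((A.op k x).act (run A B x y k))

/-- Density matrix of the message that Al sends in his turn `k`. -/
def msgAl (A : Strategy X qB qA) (B : Strategy Y qA fun k => qB (k + 1)) (x : X) (y : Y) (k : ℕ) :
    Matrix (Reg (qA k)) (Reg (qA k)) ℂ :=
  trFst (trSnd (runMid A B x y k))

/-- Density matrix of the message that Bob sends in his turn `k`. -/
def msgBob (A : Strategy X qB qA) (B : Strategy Y qA fun k => qB (k + 1)) (x : X) (y : Y) (k : ℕ) :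
    Matrix (Reg (qB (k + 1))) (Reg (qB (k + 1))) ℂ :=
  trFst (trSnd (run A B x y (k + 1)))

end Run

/-! ## Quantum protocols -/

/-- A quantum protocol without prior entanglement and without public coin. The players alternate,
Al moves first (possibly with an empty message); each of them has `rounds` turns. Private qubits
start in `|0⟩`; the operations are unitary, and measurements are made at the end: both players then
measure the qubits they hold in the standard basis and read off the result. -/
structure Protocol (X Y Z : Type) where
  rounds : ℕ
  qA : ℕ → ℕ
  qB : ℕ → ℕ
  qB_zero : qB 0 = 0
  al : Strategy X qB qA
  bob : Strategy Y qA fun k => qB (k + 1)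
  al_unitary : ∀ k x, (al.op k x).IsUnitary
  bob_unitary : ∀ k y, (bob.op k y).IsUnitary
  outAl : Reg (al.priv rounds) × Reg (qB rounds) → Z
  outBob : Reg (bob.priv rounds) → Z

/-- The classical-quantum state `∑ μ(x,y) σ_{xy} ⊗ |x⟩⟨x| ⊗ |y, f(x,y)⟩⟨y, f(x,y)|`. -/
def cqState {X Y Z R : Type} [Fintype X] [DecidableEq X] [Fintype Y] [DecidableEq Y]
    [DecidableEq Z] (f : X → Y → Z) (μ : X × Y → ℝ) (σ : X → Y → Matrix R R ℂ) :
    Matrix (R × X × (Y × Z)) (R × X × (Y × Z)) ℂ :=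
  ∑ x, ∑ y, (μ (x, y) : ℂ) • (σ x y ⊗ₖ
    (Matrix.single x x (1 : ℂ) ⊗ₖ Matrix.single (y, f x y) (y, f x y) (1 : ℂ)))

/-- `I(R : X | Y, f(X,Y))` when the inputs have distribution `μ` and the register `R` is in the
state `σ x y` on inputs `x, y`. -/
def divulged {X Y Z R : Type} [Fintype X] [DecidableEq X] [Fintype Y] [DecidableEq Y]
    [Fintype Z] [DecidableEq Z] [Fintype R] [DecidableEq R]
    (f : X → Y → Z) (μ : X × Y → ℝ) (σ : X → Y → Matrix R R ℂ) : ℝ :=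
  condMutualInfo (cqState f μ σ)

namespace Protocol

variable {X Y Z : Type}

/-- The number of qubits exchanged. -/
def communication (P : Protocol X Y Z) : ℕ :=
  ∑ k ∈ Finset.range P.rounds, (P.qA k + P.qB (k + 1))

open Classical in
/-- On inputs `x, y`, the probability that both players output `z`. -/
def outputProb (P : Protocol X Y Z) (x : X) (y : Y) (z : Z) : ℝ :=
  ∑ i, if P.outAl i.1 = z ∧ P.outBob i.2 = z then (run P.al P.bob x y P.rounds i i).re else 0

/-- `P` computes `f` with error `ε`. -/
def Computes (P : Protocol X Y Z) (f : X → Y → Z) (ε : ℝ) : Prop :=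
  ∀ x y, 1 - ε ≤ P.outputProb x y (f x y)

/-- A strategy of Al is honest during his first `k` turns: whatever the inputs are, against a Bob
who follows the protocol, each message that Al sends has the density matrix that the protocol
prescribes. Every operation that respects this is allowed. -/
def HonestAl (P : Protocol X Y Z) (A : Strategy X P.qB P.qA) (k : ℕ) : Prop :=
  ∀ x y, ∀ j < k, msgAl A P.bob x y j = msgAl P.al P.bob x y j

/-- A strategy of Bob is honest during his first `k` turns. -/
def HonestBob (P : Protocol X Y Z) (B : Strategy Y P.qA fun k => P.qB (k + 1)) (k : ℕ) : Prop :=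
  ∀ x y, ∀ j < k, msgBob P.al B x y j = msgBob P.al P.bob x y j

variable [Fintype X] [DecidableEq X] [Fintype Y] [DecidableEq Y] [Fintype Z] [DecidableEq Z]

/-- The privacy loss of `P`, as a protocol for `f`, is at most `δ`: for every distribution of the
inputs, every strategy of one player against the other one following the protocol, and every point
of time (after any number of messages) up to which the strategy is honest, the qubits in the
player's hands, which include the message just received, give at most `δ` bits of information
about the other player's input beyond his own input and the value of `f`. -/
def PrivacyLossLE (P : Protocol X Y Z) (f : X → Y → Z) (δ : ℝ) : Prop :=
  ∀ μ ∈ stdSimplex ℝ (X × Y),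
    (∀ A : Strategy X P.qB P.qA, ∀ k,
      (k ≤ P.rounds → P.HonestAl A k →
        divulged (fun y x => f x y) (fun p => μ p.swap)
          (fun y x => trSnd (run A P.bob x y k)) ≤ δ) ∧
      (k < P.rounds → P.HonestAl A (k + 1) →
        divulged (fun y x => f x y) (fun p => μ p.swap)
          (fun y x => trFst (runMid A P.bob x y k)) ≤ δ)) ∧
    (∀ B : Strategy Y P.qA fun k => P.qB (k + 1), ∀ k,
      (k ≤ P.rounds → P.HonestBob B k →
        divulged f μ (fun x y => trFst (run P.al B x y k)) ≤ δ) ∧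
      (k < P.rounds → P.HonestBob B k →
        divulged f μ (fun x y => trSnd (runMid P.al B x y k)) ≤ δ))

end Protocol

/-- Set disjointness on subsets of an `n`-element universe. -/
def disj (n : ℕ) (x y : Finset (Fin n)) : Bool := decide (Disjoint x y)

end QPrivacy

end

/-! The protocol is a distributed Grover search for a common element. A register holding an index
`i`, the flag `x i` and a counter travels to and fro: Bob multiplies the amplitudes of the common
elements by a phase `ω`; Al removes the flag, inverts about the mean and restores the flag. About
`√n` round trips of `O(log n)` qubits suffice.

Privacy rests on three facts.

No information without disturbance. All prescribed messages except Bob's last are pure. A player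
receives one of several pairwise nonorthogonal pure states and must return pure states with the same
inner products; then his private register is left unentangled with the message, in a state that does
not depend on which one he received (`exists_app_eq_kronecker`). By induction over the turns an
honest player accumulates nothing (`exists_runMid_bob`, `exists_runMid_al`).

Domination. Hence a player who has just received a message holds `σ ⊗ ρ`, where `σ` depends on his
own input only and `ρ` lives on `q` qubits. This is at most `2 ^ q` times `σ ⊗ mixed`, and an
ensemble of states below `D τ` carries at most `log₂ D` bits (`entropy_sum_le`, `divulged_le`). So
the loss is at most `q = O(log n)`, which is even better than the claimed `log² n`.

Nonorthogonality. With Grover's phase `-1` two messages might be orthogonal, so `ω = e^{iθ}` is used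
instead. The inner products are real analytic in `θ` and nonzero at `θ = 0`, where Bob does nothing;
so their zeros are isolated, and some `θ` close to `π` avoids them all (`exists_phase`).

For correctness, the number of common elements is unknown, so the counter `j` is in uniform
superposition over `M = 4√N` values and `j` iterations are made in branch `j`. With `ω = -1` the
average success probability is at least `7/16` (`le_success_neg_one`), hence above `3/7` for `ω`
close to `-1`. Two parallel copies both fail with probability below `(4/7)² < 1/3`; disjoint inputs
never lead to an error. -/

noncomputable section

namespace QPrivacy

open scoped ComplexOrder

set_option linter.unusedSectionVars false

/-! ### Entropy, relative entropy and a Holevo bound by domination. -/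

section Entropy

variable {α β : Type} [Fintype α] [DecidableEq α] [Fintype β] [DecidableEq β]

lemma entropy_eq_sum_negMulLog {A : Matrix α α ℂ} (hA : A.IsHermitian) :
    entropy A = (∑ i, Real.negMulLog (hA.eigenvalues i)) / Real.log 2 := by
  rw [entropy, hA.roots_charpoly_eq_eigenvalues, Multiset.map_map, Finset.sum_div]
  refine Finset.sum_congr rfl fun i _ => ?_
  simp only [Function.comp, Real.negMulLog, Real.logb]
  simp
  ring

lemma entropy_diagonal (d : α → ℝ) :
    entropy (Matrix.diagonal fun i => (d i : ℂ)) =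
      (∑ i, Real.negMulLog (d i)) / Real.log 2 := by
  rw [entropy, Matrix.charpoly_diagonal, Polynomial.roots_prod _ _
    (Finset.prod_ne_zero_iff.2 fun i _ => Polynomial.X_sub_C_ne_zero _)]
  simp only [Polynomial.roots_X_sub_C, Multiset.bind_singleton, Multiset.map_map]
  rw [Finset.sum_div]
  refine Finset.sum_congr rfl fun i _ => ?_
  simp only [Function.comp, Real.negMulLog, Real.logb]
  simp
  ring

lemma charpoly_blockDiagonal (M : β → Matrix α α ℂ) :
    (Matrix.blockDiagonal M).charpoly = ∏ b, (M b).charpoly := by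
  have h : (Matrix.blockDiagonal M).charmatrix =
      Matrix.blockDiagonal fun b => (M b).charmatrix := by
    ext ⟨i, b⟩ ⟨j, c⟩
    by_cases hb : b = c
    · by_cases hi : i = j <;> simp [Matrix.charmatrix, Matrix.blockDiagonal_apply, hb, hi]
    · simp [Matrix.blockDiagonal_apply, hb]
  rw [Matrix.charpoly, h, Matrix.det_blockDiagonal]
  rfl

lemma entropy_blockDiagonal (M : β → Matrix α α ℂ) :
    entropy (Matrix.blockDiagonal M) = ∑ b, entropy (M b) := by
  rw [entropy, charpoly_blockDiagonal, Polynomial.roots_prod _ _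
    (Finset.prod_ne_zero_iff.2 fun i _ => (Matrix.charpoly_monic _).ne_zero)]
  rw [Multiset.map_bind, Multiset.sum_bind]
  rfl

/-- The overlaps between the eigenvectors of `W` and those of `τ`. -/
def overlap {W τ : Matrix α α ℂ} (hW : W.IsHermitian) (hτ : τ.IsHermitian) (i j : α) : ℝ :=
  Complex.normSq (((hτ.eigenvectorUnitary : Matrix α α ℂ)ᴴ *
    (hW.eigenvectorUnitary : Matrix α α ℂ)) j i)

/-- `-Tr (W ln τ)`. -/
def crossEntropy {τ : Matrix α α ℂ} (hτ : τ.IsHermitian) (W : Matrix α α ℂ) : ℝ :=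
  -∑ j, (((hτ.eigenvectorUnitary : Matrix α α ℂ)ᴴ * W *
    (hτ.eigenvectorUnitary : Matrix α α ℂ)) j j).re * Real.log (hτ.eigenvalues j)

lemma crossEntropy_sum {ι : Type} (s : Finset ι) {τ : Matrix α α ℂ} (hτ : τ.IsHermitian)
    (W : ι → Matrix α α ℂ) :
    crossEntropy hτ (∑ x ∈ s, W x) = ∑ x ∈ s, crossEntropy hτ (W x) := by
  simp only [crossEntropy, Finset.mul_sum, Finset.sum_mul, Matrix.sum_apply, Complex.re_sum,
    Finset.sum_neg_distrib]
  rw [Finset.sum_comm]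

lemma overlap_nonneg {W τ : Matrix α α ℂ} (hW : W.IsHermitian) (hτ : τ.IsHermitian) (i j : α) :
    0 ≤ overlap hW hτ i j := Complex.normSq_nonneg _

lemma sum_normSq_col {Q : Matrix α α ℂ} (hQ : Qᴴ * Q = 1) (i : α) :
    ∑ j, Complex.normSq (Q j i) = 1 := by
  have h := congrFun (congrFun hQ i) i
  rw [Matrix.mul_apply, Matrix.one_apply_eq] at h
  have h2 := congrArg Complex.re h
  simpa [Complex.normSq_apply] using h2

lemma sum_normSq_row {Q : Matrix α α ℂ} (hQ : Q * Qᴴ = 1) (i : α) :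
    ∑ j, Complex.normSq (Q i j) = 1 := by
  have h := congrFun (congrFun hQ i) i
  rw [Matrix.mul_apply, Matrix.one_apply_eq] at h
  have h2 := congrArg Complex.re h
  simpa [Complex.normSq_apply] using h2

lemma eigenvectorUnitary_conjTranspose_mul {A : Matrix α α ℂ} (hA : A.IsHermitian) :
    (hA.eigenvectorUnitary : Matrix α α ℂ)ᴴ * (hA.eigenvectorUnitary : Matrix α α ℂ) = 1 :=
  Unitary.coe_star_mul_self hA.eigenvectorUnitary

lemma eigenvectorUnitary_mul_conjTranspose {A : Matrix α α ℂ} (hA : A.IsHermitian) :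
    (hA.eigenvectorUnitary : Matrix α α ℂ) * (hA.eigenvectorUnitary : Matrix α α ℂ)ᴴ = 1 :=
  Unitary.coe_mul_star_self hA.eigenvectorUnitary

lemma eq_eigenvectorUnitary_mul {A : Matrix α α ℂ} (hA : A.IsHermitian) :
    A = (hA.eigenvectorUnitary : Matrix α α ℂ) *
      Matrix.diagonal (fun i => (hA.eigenvalues i : ℂ)) *
      (hA.eigenvectorUnitary : Matrix α α ℂ)ᴴ := by
  conv_lhs => rw [hA.spectral_theorem]
  rfl

lemma sum_overlap_left {W τ : Matrix α α ℂ} (hW : W.IsHermitian) (hτ : τ.IsHermitian) (i : α) :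
    ∑ j, overlap hW hτ i j = 1 := by
  refine sum_normSq_col ?_ i
  rw [Matrix.conjTranspose_mul, Matrix.conjTranspose_conjTranspose, Matrix.mul_assoc,
    ← Matrix.mul_assoc _ _ (hW.eigenvectorUnitary : Matrix α α ℂ),
    eigenvectorUnitary_mul_conjTranspose, Matrix.one_mul, eigenvectorUnitary_conjTranspose_mul]

lemma sum_overlap_right {W τ : Matrix α α ℂ} (hW : W.IsHermitian) (hτ : τ.IsHermitian) (j : α) :
    ∑ i, overlap hW hτ i j = 1 := by
  refine sum_normSq_row ?_ j
  rw [Matrix.conjTranspose_mul, Matrix.conjTranspose_conjTranspose, Matrix.mul_assoc,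
    ← Matrix.mul_assoc _ _ (hτ.eigenvectorUnitary : Matrix α α ℂ),
    eigenvectorUnitary_mul_conjTranspose, Matrix.one_mul, eigenvectorUnitary_conjTranspose_mul]

lemma conj_eigenvectorUnitary_eq {W τ : Matrix α α ℂ} (hW : W.IsHermitian) (hτ : τ.IsHermitian) :
    (hτ.eigenvectorUnitary : Matrix α α ℂ)ᴴ * W * (hτ.eigenvectorUnitary : Matrix α α ℂ) =
      ((hτ.eigenvectorUnitary : Matrix α α ℂ)ᴴ * (hW.eigenvectorUnitary : Matrix α α ℂ)) *
        Matrix.diagonal (fun i => (hW.eigenvalues i : ℂ)) *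
      ((hτ.eigenvectorUnitary : Matrix α α ℂ)ᴴ * (hW.eigenvectorUnitary : Matrix α α ℂ))ᴴ := by
  conv_lhs => rw [eq_eigenvectorUnitary_mul hW]
  simp only [Matrix.conjTranspose_mul, Matrix.conjTranspose_conjTranspose, Matrix.mul_assoc]

/-- In the two eigenbases the quantum quantity becomes a classical one, with the doubly stochastic
matrix `overlap` linking the two spectra. The entropy inequalities below then need only scalar
estimates. -/
lemma crossEntropy_eq {W τ : Matrix α α ℂ} (hW : W.IsHermitian) (hτ : τ.IsHermitian) :
    crossEntropy hτ W = -∑ i, ∑ j,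
      hW.eigenvalues i * overlap hW hτ i j * Real.log (hτ.eigenvalues j) := by
  rw [crossEntropy, Finset.sum_comm, conj_eigenvectorUnitary_eq hW hτ]
  congr 1
  refine Finset.sum_congr rfl fun j _ => ?_
  rw [← Finset.sum_mul, Matrix.mul_apply, Complex.re_sum]
  congr 1
  refine Finset.sum_congr rfl fun i _ => ?_
  rw [Matrix.mul_diagonal, Matrix.conjTranspose_apply, overlap, Complex.normSq_apply]
  simp
  ring

/-- The quadratic form of `W ≤ c τ` in the eigenbasis of `τ`. -/
lemma sum_eigenvalues_mul_normSq_le {W τ : Matrix α α ℂ} (hW : W.IsHermitian)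
    (hτ : τ.IsHermitian) {c : ℝ} (h : ((c : ℂ) • τ - W).PosSemidef) (v : α → ℂ) :
    ∑ i, hW.eigenvalues i * Complex.normSq (∑ j,
      star (((hτ.eigenvectorUnitary : Matrix α α ℂ)ᴴ *
        (hW.eigenvectorUnitary : Matrix α α ℂ)) j i) * v j) ≤
      c * ∑ j, hτ.eigenvalues j * Complex.normSq (v j) := by
  set Q := (hτ.eigenvectorUnitary : Matrix α α ℂ)ᴴ * (hW.eigenvectorUnitary : Matrix α α ℂ)
    with hQ
  have h1 := h.conjTranspose_mul_mul_same (hτ.eigenvectorUnitary : Matrix α α ℂ)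
  rw [Matrix.mul_sub, Matrix.sub_mul, conj_eigenvectorUnitary_eq hW hτ, ← hQ,
    Matrix.mul_smul, Matrix.smul_mul, conj_eigenvectorUnitary_eq hτ hτ,
    eigenvectorUnitary_conjTranspose_mul, Matrix.conjTranspose_one, Matrix.mul_one,
    Matrix.one_mul] at h1
  have h2 := h1.re_dotProduct_nonneg v
  rw [Matrix.sub_mulVec, dotProduct_sub, map_sub, sub_nonneg] at h2
  have e1 : star v ⬝ᵥ ((Q * Matrix.diagonal (fun i => (hW.eigenvalues i : ℂ)) * Qᴴ) *ᵥ v) =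
      ((∑ i, hW.eigenvalues i * Complex.normSq (∑ j, star (Q j i) * v j) : ℝ) : ℂ) := by
    rw [← Matrix.mulVec_mulVec, ← Matrix.mulVec_mulVec, Matrix.dotProduct_mulVec,
      show star v ᵥ* Q = star (Qᴴ *ᵥ v) by rw [Matrix.star_mulVec,
        Matrix.conjTranspose_conjTranspose]]
    rw [dotProduct]
    push_cast
    refine Finset.sum_congr rfl fun i _ => ?_
    rw [Matrix.mulVec_diagonal, Complex.normSq_eq_conj_mul_self]
    have : (Qᴴ *ᵥ v) i = ∑ j, star (Q j i) * v j := rfl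
    rw [Pi.star_apply, this, Complex.star_def]
    ring
  have e2 : star v ⬝ᵥ (((c : ℂ) • Matrix.diagonal (fun i => (hτ.eigenvalues i : ℂ))) *ᵥ v) =
      ((c * ∑ j, hτ.eigenvalues j * Complex.normSq (v j) : ℝ) : ℂ) := by
    rw [Matrix.smul_mulVec, dotProduct_smul, dotProduct]
    push_cast
    rw [smul_eq_mul]
    congr 1
    refine Finset.sum_congr rfl fun i _ => ?_
    rw [Matrix.mulVec_diagonal, Complex.normSq_eq_conj_mul_self, Pi.star_apply, Complex.star_def]
    ring
  rw [e1, e2] at h2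
  simpa using h2

/-- The quadratic form of `W ≤ c τ` at a null eigenvector of `τ` is a vanishing sum of nonnegative
terms. This makes the default values `log 0 = 0` and `0⁻¹ = 0` harmless below. -/
lemma eigenvalue_mul_overlap_eq_zero {W τ : Matrix α α ℂ} (hW : W.PosSemidef)
    (hτ : τ.PosSemidef) {c : ℝ} (h : ((c : ℂ) • τ - W).PosSemidef) {i j : α}
    (hj : hτ.1.eigenvalues j = 0) : hW.1.eigenvalues i * overlap hW.1 hτ.1 i j = 0 := by
  have h1 := sum_eigenvalues_mul_normSq_le hW.1 hτ.1 h (Pi.single j 1)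
  have h2 : ∑ k, hτ.1.eigenvalues k * Complex.normSq ((Pi.single j 1 : α → ℂ) k) = 0 := by
    refine Finset.sum_eq_zero fun k _ => ?_
    by_cases hk : k = j
    · subst hk; simp [hj]
    · simp [hk]
  rw [h2, mul_zero] at h1
  have h3 : ∀ i, 0 ≤ hW.1.eigenvalues i * overlap hW.1 hτ.1 i j := fun i =>
    mul_nonneg (hW.eigenvalues_nonneg i) (overlap_nonneg _ _ _ _)
  have h4 : ∑ i, hW.1.eigenvalues i * overlap hW.1 hτ.1 i j ≤ 0 := by
    refine le_trans (le_of_eq ?_) h1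
    refine Finset.sum_congr rfl fun i _ => ?_
    congr 1
    simp [overlap, Pi.single_apply]
  exact (Finset.sum_eq_zero_iff_of_nonneg fun i _ => h3 i).1
    (le_antisymm h4 (Finset.sum_nonneg fun i _ => h3 i)) i (Finset.mem_univ _)

/-- The hypothesis is tested on `v = τ⁻¹ e`, where `e` is the `i`-th eigenvector of `W` in the
eigenbasis of `τ`. With `s = ⟨e, τ⁻¹ e⟩` (pseudoinverse) this gives `a i * s² ≤ c * s`. The bound
replaces the operator monotonicity of the logarithm. -/
lemma mul_sum_normSq_mul_inv_le {a b : α → ℝ} (ha : ∀ i, 0 ≤ a i) (hb : ∀ i, 0 ≤ b i)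
    {Q : Matrix α α ℂ} {c : ℝ} (hc : 0 ≤ c)
    (h : ∀ v : α → ℂ, ∑ i, a i * Complex.normSq (∑ j, star (Q j i) * v j) ≤
      c * ∑ j, b j * Complex.normSq (v j)) (i : α) :
    a i * ∑ j, Complex.normSq (Q j i) * (b j)⁻¹ ≤ c := by
  set s := ∑ j, Complex.normSq (Q j i) * (b j)⁻¹ with hs
  have hs0 : 0 ≤ s := Finset.sum_nonneg fun j _ =>
    mul_nonneg (Complex.normSq_nonneg _) (inv_nonneg.2 (hb j))
  have h1 := h fun j => Q j i * ((b j)⁻¹ : ℝ)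
  have e1 : ∑ j, b j * Complex.normSq (Q j i * ((b j)⁻¹ : ℝ)) = s := by
    refine Finset.sum_congr rfl fun j _ => ?_
    rw [Complex.normSq_mul, Complex.normSq_ofReal]
    rcases eq_or_ne (b j) 0 with h0 | h0
    · simp [h0]
    · field_simp
  have e2 : ∑ j, star (Q j i) * (Q j i * ((b j)⁻¹ : ℝ)) = (s : ℂ) := by
    rw [hs]
    push_cast
    refine Finset.sum_congr rfl fun j _ => ?_
    rw [← mul_assoc, Complex.star_def, ← Complex.normSq_eq_conj_mul_self]
  rw [e1] at h1
  have h2 : a i * Complex.normSq (∑ j, star (Q j i) * (Q j i * ((b j)⁻¹ : ℝ))) ≤ c * s :=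
    (Finset.single_le_sum (f := fun k => a k *
      Complex.normSq (∑ j, star (Q j k) * (Q j i * ((b j)⁻¹ : ℝ))))
      (fun k _ => mul_nonneg (ha k) (Complex.normSq_nonneg _)) (Finset.mem_univ i)).trans h1
  rw [e2, Complex.normSq_ofReal] at h2
  rcases hs0.eq_or_lt with h0 | h0
  · rw [← h0, mul_zero]; exact hc
  · nlinarith

lemma eigenvalue_mul_sum_overlap_div_le {W τ : Matrix α α ℂ} (hW : W.PosSemidef)
    (hτ : τ.PosSemidef) {c : ℝ} (hc : 0 ≤ c) (h : ((c : ℂ) • τ - W).PosSemidef) (i : α) :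
    hW.1.eigenvalues i * ∑ j, overlap hW.1 hτ.1 i j * (hτ.1.eigenvalues j)⁻¹ ≤ c :=
  mul_sum_normSq_mul_inv_le hW.eigenvalues_nonneg hτ.eigenvalues_nonneg hc
    (sum_eigenvalues_mul_normSq_le hW.1 hτ.1 h) i

lemma trace_eq_sum_eigenvalues_real {W : Matrix α α ℂ} (hW : W.IsHermitian) {q : ℝ}
    (hq : W.trace = q) : ∑ i, hW.eigenvalues i = q := by
  rw [hW.trace_eq_sum_eigenvalues] at hq
  have := congrArg Complex.re hq
  simpa using this

/-- The Gibbs inequality. -/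
lemma sum_negMulLog_le_crossEntropy {W τ : Matrix α α ℂ} (hW : W.PosSemidef)
    (hτ : τ.PosSemidef) {c q : ℝ} (h : ((c : ℂ) • τ - W).PosSemidef)
    (hq : W.trace = q) (hτ1 : τ.trace = 1) :
    ∑ i, Real.negMulLog (hW.1.eigenvalues i) ≤ Real.negMulLog q + crossEntropy hτ.1 W := by
  have ha : ∀ i, 0 ≤ hW.1.eigenvalues i := hW.eigenvalues_nonneg
  have hb : ∀ j, 0 ≤ hτ.1.eigenvalues j := hτ.eigenvalues_nonneg
  have hG : ∀ i j, 0 ≤ overlap hW.1 hτ.1 i j := overlap_nonneg _ _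
  have hsa := trace_eq_sum_eigenvalues_real hW.1 hq
  have hsb := trace_eq_sum_eigenvalues_real hτ.1 (q := 1) (by simpa using hτ1)
  have hq0 : 0 ≤ q := hsa ▸ Finset.sum_nonneg fun i _ => ha i
  rw [crossEntropy_eq hW.1]
  -- This is `log t ≤ t - 1` at `t = q b_j / a_i`. By double stochasticity the right sides add up to
  -- `q - q = 0`.
  have key : ∀ i j, hW.1.eigenvalues i * overlap hW.1 hτ.1 i j *
      (Real.log q + Real.log (hτ.1.eigenvalues j) - Real.log (hW.1.eigenvalues i)) ≤
      overlap hW.1 hτ.1 i j * (q * hτ.1.eigenvalues j - hW.1.eigenvalues i) := by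
    intro i j
    rcases (ha i).eq_or_lt with h0 | h0
    · rw [← h0]
      simp only [zero_mul, sub_zero]
      exact mul_nonneg (hG i j) (mul_nonneg hq0 (hb j))
    have hq1 : 0 < q := hsa ▸ h0.trans_le
      (Finset.single_le_sum (fun i _ => ha i) (Finset.mem_univ i))
    rcases (hb j).eq_or_lt with h1 | h1
    · have h2 := eigenvalue_mul_overlap_eq_zero hW hτ h (i := i) h1.symm
      have h3 : overlap hW.1 hτ.1 i j = 0 := (mul_eq_zero.1 h2).resolve_left h0.ne'
      simp [h3]
    · rw [← Real.log_mul hq1.ne' h1.ne', ← Real.log_div (mul_pos hq1 h1).ne' h0.ne']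
      have h2 := Real.log_le_sub_one_of_pos (div_pos (mul_pos hq1 h1) h0)
      calc _ ≤ hW.1.eigenvalues i * overlap hW.1 hτ.1 i j *
            (q * hτ.1.eigenvalues j / hW.1.eigenvalues i - 1) :=
            mul_le_mul_of_nonneg_left h2 (mul_nonneg (ha i) (hG i j))
        _ = _ := by field_simp
  have hsum := Finset.sum_le_sum fun i (_ : i ∈ Finset.univ) =>
    Finset.sum_le_sum fun j (_ : j ∈ Finset.univ) => key i j
  have e1 : ∑ i, ∑ j, overlap hW.1 hτ.1 i j * (q * hτ.1.eigenvalues j - hW.1.eigenvalues i) =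
      0 := by
    simp only [mul_sub, Finset.sum_sub_distrib]
    rw [Finset.sum_comm]
    simp only [← Finset.sum_mul, sum_overlap_left, sum_overlap_right, one_mul]
    rw [← Finset.mul_sum, hsa, hsb]
    ring
  have e2 : ∑ i, ∑ j, hW.1.eigenvalues i * overlap hW.1 hτ.1 i j *
      (Real.log q + Real.log (hτ.1.eigenvalues j) - Real.log (hW.1.eigenvalues i)) =
      q * Real.log q + ∑ i, ∑ j, hW.1.eigenvalues i * overlap hW.1 hτ.1 i j *
        Real.log (hτ.1.eigenvalues j) + ∑ i, Real.negMulLog (hW.1.eigenvalues i) := by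
    simp only [mul_sub, mul_add, Finset.sum_sub_distrib, Finset.sum_add_distrib]
    simp only [← Finset.sum_mul, ← Finset.mul_sum, sum_overlap_left, mul_one, hsa,
      Real.negMulLog, neg_mul, Finset.sum_neg_distrib]
    ring
  rw [e1, e2] at hsum
  simp only [Real.negMulLog] at hsum ⊢
  linarith

/-- The relative entropy is at most the logarithm of the largest ratio. -/
lemma crossEntropy_le_sum_negMulLog {W τ : Matrix α α ℂ} (hW : W.PosSemidef)
    (hτ : τ.PosSemidef) {D p : ℝ} (hD : 1 ≤ D) (h : (((p * D : ℝ) : ℂ) • τ - W).PosSemidef)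
    (hp : W.trace = p) :
    crossEntropy hτ.1 W ≤
      ∑ i, Real.negMulLog (hW.1.eigenvalues i) - Real.negMulLog p + p * Real.log D := by
  have ha : ∀ i, 0 ≤ hW.1.eigenvalues i := hW.eigenvalues_nonneg
  have hb : ∀ j, 0 ≤ hτ.1.eigenvalues j := hτ.eigenvalues_nonneg
  have hG : ∀ i j, 0 ≤ overlap hW.1 hτ.1 i j := overlap_nonneg _ _
  have hsa := trace_eq_sum_eigenvalues_real hW.1 hp
  have hp0 : 0 ≤ p := hsa ▸ Finset.sum_nonneg fun i _ => ha i
  have hD0 : 0 < D := by linarith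
  rw [crossEntropy_eq hW.1, ← Finset.sum_neg_distrib]
  have key : ∀ i, -∑ j, hW.1.eigenvalues i * overlap hW.1 hτ.1 i j *
      Real.log (hτ.1.eigenvalues j) ≤
      Real.negMulLog (hW.1.eigenvalues i) +
        hW.1.eigenvalues i * (Real.log p + Real.log D) := by
    intro i
    rcases (ha i).eq_or_lt with h0 | h0
    · simp [← h0]
    have hp1 : 0 < p := hsa ▸ h0.trans_le
      (Finset.single_le_sum (fun i _ => ha i) (Finset.mem_univ i))
    have hc : 0 < p * D := mul_pos hp1 hD0
    -- Again `log t ≤ t - 1`, now at `t = a_i / (p D b_j)`. Summed over `j`, the term linear in `t`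
    -- is at most `a_i` by the bound on `⟨e, τ⁻¹ e⟩`, which cancels the `-1`.
    have step : ∀ j, -(hW.1.eigenvalues i * overlap hW.1 hτ.1 i j *
        Real.log (hτ.1.eigenvalues j)) ≤
        hW.1.eigenvalues i * (hW.1.eigenvalues i / (p * D) *
          (overlap hW.1 hτ.1 i j * (hτ.1.eigenvalues j)⁻¹)) +
        overlap hW.1 hτ.1 i j * (hW.1.eigenvalues i *
          (Real.log (p * D) - Real.log (hW.1.eigenvalues i) - 1)) := by
      intro j
      rcases (hb j).eq_or_lt with h1 | h1
      · have h2 := eigenvalue_mul_overlap_eq_zero hW hτ h (i := i) h1.symm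
        have h3 : overlap hW.1 hτ.1 i j = 0 := (mul_eq_zero.1 h2).resolve_left h0.ne'
        simp [h3]
      · have h2 := Real.log_le_sub_one_of_pos (div_pos (div_pos h0 hc) h1)
        rw [Real.log_div (div_pos h0 hc).ne' h1.ne', Real.log_div h0.ne' hc.ne'] at h2
        have h3 := mul_le_mul_of_nonneg_left h2 (mul_nonneg (ha i) (hG i j))
        have h4 : hW.1.eigenvalues i * overlap hW.1 hτ.1 i j *
            (hW.1.eigenvalues i / (p * D) / hτ.1.eigenvalues j - 1) =
            hW.1.eigenvalues i * (hW.1.eigenvalues i / (p * D) *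
              (overlap hW.1 hτ.1 i j * (hτ.1.eigenvalues j)⁻¹)) -
            hW.1.eigenvalues i * overlap hW.1 hτ.1 i j := by
          rw [div_eq_mul_inv (_ / _) (hτ.1.eigenvalues j)]; ring
        rw [h4] at h3
        linarith
    rw [← Finset.sum_neg_distrib]
    refine (Finset.sum_le_sum fun j _ => step j).trans ?_
    rw [Finset.sum_add_distrib, ← Finset.mul_sum, ← Finset.mul_sum, ← Finset.sum_mul,
      sum_overlap_left, one_mul, Real.log_mul hp1.ne' hD0.ne']
    have h5 := eigenvalue_mul_sum_overlap_div_le hW hτ hc.le h i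
    have h6 : hW.1.eigenvalues i / (p * D) *
        ∑ j, overlap hW.1 hτ.1 i j * (hτ.1.eigenvalues j)⁻¹ ≤ 1 := by
      rw [div_mul_eq_mul_div, div_le_one hc]
      exact h5
    have h7 := mul_le_mul_of_nonneg_left h6 (ha i)
    simp only [Real.negMulLog]
    linarith
  refine (Finset.sum_le_sum fun i _ => key i).trans (le_of_eq ?_)
  rw [Finset.sum_add_distrib, ← Finset.sum_mul, hsa]
  simp only [Real.negMulLog]
  ring

/-- A Holevo bound: an ensemble of states dominated by `D τ` carries at most `log₂ D` bits. -/
lemma entropy_sum_le {ι : Type} [Fintype ι] (W : ι → Matrix α α ℂ) (p : ι → ℝ)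
    {τ : Matrix α α ℂ} {D : ℝ} (hD : 1 ≤ D) (hW : ∀ x, (W x).PosSemidef) (hτ : τ.PosSemidef)
    (hτ1 : τ.trace = 1) (hp : ∀ x, (W x).trace = p x)
    (h : ∀ x, (((p x * D : ℝ) : ℂ) • τ - W x).PosSemidef) :
    entropy (∑ x, W x) + (∑ x, Real.negMulLog (p x)) / Real.log 2 ≤
      (∑ x, entropy (W x)) + Real.negMulLog (∑ x, p x) / Real.log 2 +
        (∑ x, p x) * Real.logb 2 D := by
  have hS : (∑ x, W x).PosSemidef := Matrix.posSemidef_sum _ fun x _ => hW x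
  have h1 : (((∑ x, p x * D : ℝ) : ℂ) • τ - ∑ x, W x).PosSemidef := by
    have := Matrix.posSemidef_sum Finset.univ fun x _ => h x
    rwa [Finset.sum_sub_distrib, ← Finset.sum_smul, ← Complex.ofReal_sum] at this
  have h2 := sum_negMulLog_le_crossEntropy hS hτ (q := ∑ x, p x) h1
    (by rw [Matrix.trace_sum]; simp [hp]) hτ1
  rw [crossEntropy_sum] at h2
  have h3 := Finset.sum_le_sum fun x (_ : x ∈ Finset.univ) =>
    crossEntropy_le_sum_negMulLog (hW x) hτ hD (h x) (hp x)
  rw [Finset.sum_add_distrib, Finset.sum_sub_distrib, ← Finset.sum_mul] at h3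
  rw [entropy_eq_sum_negMulLog hS.1,
    Finset.sum_congr rfl fun x _ => entropy_eq_sum_negMulLog (hW x).1,
    ← Finset.sum_div, Real.logb, ← mul_div_assoc, ← add_div, ← add_div, ← add_div]
  refine div_le_div_of_nonneg_right ?_ (Real.log_nonneg (by norm_num))
  linarith

end Entropy

/-! ### From domination to a bound on the divulged information. -/

section Divulged

variable {X Y Z R : Type} [Fintype X] [DecidableEq X] [Fintype Y] [DecidableEq Y]
  [DecidableEq Z]

/-- Since `X`, `Y` and `F` are classical, the state splits into blocks, and each entropy in the
conditional mutual information becomes a sum over blocks. -/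
lemma cqState_eq_blockDiagonal (f : X → Y → Z) (μ : X × Y → ℝ) (σ : X → Y → Matrix R R ℂ) :
    cqState f μ σ = Matrix.blockDiagonal fun w : X × (Y × Z) =>
      if f w.1 w.2.1 = w.2.2 then (μ (w.1, w.2.1) : ℂ) • σ w.1 w.2.1 else 0 := by
  ext ⟨r, x, y, z⟩ ⟨r', x', y', z'⟩
  simp only [cqState, Matrix.sum_apply, Matrix.smul_apply, Matrix.kroneckerMap_apply,
    Matrix.blockDiagonal_apply, Matrix.single_apply, smul_eq_mul, Prod.mk.injEq]
  rw [Finset.sum_eq_single x (fun b _ hb => by simp [hb]) (by simp),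
    Finset.sum_eq_single y (fun b _ hb => by simp [hb]) (by simp)]
  by_cases hx : x = x' <;> by_cases hy : y = y' <;> by_cases hz : z = z' <;>
    by_cases hf : f x y = z <;> simp_all

/-- For each value of `(Y, F)` the Holevo bound applies to the ensemble over `x`, with reference
state `τ y`. The weights of all these ensembles add up to `1`, so `log₂ D` appears just once. -/
lemma divulged_le [Fintype Z] [Fintype R] [DecidableEq R] (f : X → Y → Z)
    {μ : X × Y → ℝ} (hμ : μ ∈ stdSimplex ℝ (X × Y))
    {σ : X → Y → Matrix R R ℂ} {τ : Y → Matrix R R ℂ} {D : ℝ} (hD : 1 ≤ D)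
    (hσ : ∀ x y, (σ x y).PosSemidef) (hσ1 : ∀ x y, (σ x y).trace = 1)
    (hτ : ∀ y, (τ y).PosSemidef) (hτ1 : ∀ y, (τ y).trace = 1)
    (h : ∀ x y, ((D : ℂ) • τ y - σ x y).PosSemidef) :
    divulged f μ σ ≤ Real.logb 2 D := by
  -- The joint distribution of `X` and `(Y, F)`; it vanishes off the graph of `f`.
  set p : X → Y × Z → ℝ := fun x w => if f x w.1 = w.2 then μ (x, w.1) else 0 with hp
  set W : X → Y × Z → Matrix R R ℂ := fun x w => (p x w : ℂ) • σ x w.1 with hW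
  have hp0 : ∀ x w, 0 ≤ p x w := by
    intro x w
    simp only [hp]
    split_ifs
    · exact hμ.1 _
    · exact le_rfl
  have e0 : cqState f μ σ = Matrix.blockDiagonal fun w : X × (Y × Z) => W w.1 w.2 := by
    rw [cqState_eq_blockDiagonal]
    congr 1
    ext1 w
    simp only [hW, hp]
    split_ifs <;> simp
  have e1 : trMid (cqState f μ σ) = Matrix.blockDiagonal fun w : Y × Z => ∑ x, W x w := by
    ext ⟨r, w⟩ ⟨r', w'⟩
    rw [e0]
    simp only [trMid, Matrix.of_apply, Matrix.blockDiagonal_apply, Prod.mk.injEq, true_and]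
    split_ifs with hw
    · rw [Matrix.sum_apply]
    · simp
  have e2 : trFst (cqState f μ σ) =
      Matrix.diagonal fun w : X × (Y × Z) => ((p w.1 w.2 : ℝ) : ℂ) := by
    ext w w'
    rw [e0]
    simp only [trFst, Matrix.of_apply, Matrix.blockDiagonal_apply, Matrix.diagonal_apply]
    split_ifs with hw
    · have := hσ1 w.1 w.2.1
      simp only [Matrix.trace, Matrix.diag] at this
      simp only [hW, Matrix.smul_apply, smul_eq_mul]
      rw [← Finset.mul_sum, this, mul_one]
    · simp
  have e3 : trFst (trFst (cqState f μ σ)) =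
      Matrix.diagonal fun w : Y × Z => ((∑ x, p x w : ℝ) : ℂ) := by
    rw [e2]
    ext w w'
    simp only [trFst, Matrix.of_apply, Matrix.diagonal_apply, Prod.mk.injEq, true_and]
    split_ifs with hw
    · push_cast; rfl
    · simp
  rw [divulged, condMutualInfo, e3, e2, e1, e0, entropy_blockDiagonal, entropy_blockDiagonal,
    entropy_diagonal, entropy_diagonal,
    Fintype.sum_prod_type_right (fun w : X × (Y × Z) => Real.negMulLog (p w.1 w.2)),
    Fintype.sum_prod_type_right (fun w : X × (Y × Z) => entropy (W w.1 w.2))]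
  have key := Finset.sum_le_sum fun (w : Y × Z) (_ : w ∈ Finset.univ) =>
    entropy_sum_le (fun x => W x w) (fun x => p x w) hD
      (fun x => (hσ x w.1).smul (a := (p x w : ℂ)) (by exact_mod_cast hp0 x w))
      (hτ w.1) (hτ1 w.1)
      (fun x => by simp [hW, Matrix.trace_smul, hσ1])
      (fun x => by
        have := (h x w.1).smul (a := (p x w : ℂ)) (by exact_mod_cast hp0 x w)
        rw [smul_sub, smul_smul] at this
        push_cast
        exact this)
  have hs : ∑ w : Y × Z, ∑ x, p x w = 1 := by
    rw [Finset.sum_comm, ← hμ.2, Fintype.sum_prod_type]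
    refine Finset.sum_congr rfl fun x _ => ?_
    rw [Fintype.sum_prod_type]
    refine Finset.sum_congr rfl fun y _ => ?_
    simp [hp]
  simp only [Finset.sum_add_distrib, ← Finset.sum_mul, ← Finset.sum_div] at key
  rw [hs] at key
  linarith

end Divulged

/-! ### Pure states, partial traces and operations. -/

section States

variable {P M O P' M' : Type}

/-- The projector `|ψ⟩⟨ψ|`. -/
def proj (ψ : M → ℂ) : Matrix M M ℂ := Matrix.vecMulVec ψ (star ψ)

lemma proj_apply (ψ : M → ℂ) (i j : M) : proj ψ i j = ψ i * star (ψ j) := rfl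

lemma pass_kronecker (a : Matrix P P ℂ) (b : Matrix M M ℂ) (c : Matrix O O ℂ) :
    pass ((a ⊗ₖ b) ⊗ₖ c) = (c ⊗ₖ b) ⊗ₖ a := by
  ext ⟨⟨i, j⟩, k⟩ ⟨⟨i', j'⟩, k'⟩
  simp only [pass, Matrix.submatrix_apply, Matrix.kroneckerMap_apply]
  ring

variable [Fintype P] [Fintype M] [Fintype O] [Fintype P'] [Fintype M']

lemma trFst_kronecker (a : Matrix P P ℂ) (b : Matrix M M ℂ) :
    trFst (a ⊗ₖ b) = a.trace • b := by
  ext i j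
  simp [trFst, Matrix.trace, Finset.sum_mul]

lemma trSnd_kronecker (a : Matrix P P ℂ) (b : Matrix M M ℂ) :
    trSnd (a ⊗ₖ b) = b.trace • a := by
  ext i j
  simp [trSnd, Matrix.trace, Finset.mul_sum, mul_comm]

lemma trace_trSnd (a : Matrix (P × M) (P × M) ℂ) : (trSnd a).trace = a.trace := by
  simp [trSnd, Matrix.trace, Fintype.sum_prod_type]

lemma trSnd_sub (a b : Matrix (P × M) (P × M) ℂ) : trSnd (a - b) = trSnd a - trSnd b := by
  ext i j
  simp [trSnd]

lemma trSnd_smul (c : ℂ) (a : Matrix (P × M) (P × M) ℂ) : trSnd (c • a) = c • trSnd a := by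
  ext i j
  simp [trSnd, Finset.mul_sum]

lemma posSemidef_trSnd {a : Matrix (P × M) (P × M) ℂ} (h : a.PosSemidef) :
    (trSnd a).PosSemidef := by
  have : trSnd a = ∑ m, a.submatrix (fun p => (p, m)) (fun p => (p, m)) := by
    ext i j
    simp [trSnd, Matrix.sum_apply]
  rw [this]
  exact Matrix.posSemidef_sum _ fun m _ => h.submatrix _

lemma posSemidef_proj (ψ : M → ℂ) : (proj ψ).PosSemidef :=
  Matrix.posSemidef_vecMulVec_self_star ψ

lemma trace_proj (ψ : M → ℂ) : (proj ψ).trace = star ψ ⬝ᵥ ψ := by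
  simp [proj, Matrix.trace_vecMulVec, dotProduct_comm]

lemma mul_proj_mul (V : Matrix O M ℂ) (ψ : M → ℂ) : V * proj ψ * Vᴴ = proj (V *ᵥ ψ) := by
  rw [proj, Matrix.mul_vecMulVec, Matrix.vecMulVec_mul, proj, Matrix.star_mulVec]

lemma single_zero_eq_proj [DecidableEq M] (m : M) :
    Matrix.single m m (1 : ℂ) = proj (Pi.single m 1) := by
  ext i j
  simp only [proj_apply, Matrix.single_apply, Pi.single_apply, eq_comm (a := m)]
  split_ifs <;> simp_all

lemma star_mulVec_dotProduct_mulVec [DecidableEq M] {V : Matrix O M ℂ} (hV : Vᴴ * V = 1)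
    (ψ φ : M → ℂ) : star (V *ᵥ ψ) ⬝ᵥ (V *ᵥ φ) = star ψ ⬝ᵥ φ := by
  rw [Matrix.star_mulVec, ← Matrix.dotProduct_mulVec, Matrix.mulVec_mulVec, hV,
    Matrix.one_mulVec]

end States

namespace Channel

variable {α β γ : Type} [Fintype α] [DecidableEq α] [Fintype β] [Fintype γ] [DecidableEq γ]

/-- Apply an operation to a state. -/
def app (T : Channel α β) (ρ : Matrix α α ℂ) : Matrix β β ℂ :=
  ∑ i, T.kraus i * ρ * (T.kraus i)ᴴ

lemma act_kronecker (T : Channel α β) (ρ : Matrix α α ℂ) (c : Matrix γ γ ℂ) :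
    T.act (ρ ⊗ₖ c) = T.app ρ ⊗ₖ c := by
  rw [act, app]
  have : ∀ i, (T.kraus i ⊗ₖ (1 : Matrix γ γ ℂ)) * (ρ ⊗ₖ c) *
      (T.kraus i ⊗ₖ (1 : Matrix γ γ ℂ))ᴴ = (T.kraus i * ρ * (T.kraus i)ᴴ) ⊗ₖ c := by
    intro i
    rw [Matrix.conjTranspose_kronecker, ← Matrix.mul_kronecker_mul, ← Matrix.mul_kronecker_mul]
    simp
  simp only [this]
  ext ⟨i, j⟩ ⟨i', j'⟩
  simp [Matrix.sum_apply, Finset.sum_mul]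

lemma app_sub (T : Channel α β) (ρ ρ' : Matrix α α ℂ) :
    T.app (ρ - ρ') = T.app ρ - T.app ρ' := by
  simp [app, Matrix.mul_sub, Matrix.sub_mul]

lemma app_smul (T : Channel α β) (c : ℂ) (ρ : Matrix α α ℂ) : T.app (c • ρ) = c • T.app ρ := by
  simp [app, Finset.smul_sum]

lemma app_sum {ι : Type} (s : Finset ι) (T : Channel α β) (ρ : ι → Matrix α α ℂ) :
    T.app (∑ a ∈ s, ρ a) = ∑ a ∈ s, T.app (ρ a) := by
  simp only [app, Matrix.mul_sum, Matrix.sum_mul]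
  rw [Finset.sum_comm]

lemma posSemidef_app (T : Channel α β) {ρ : Matrix α α ℂ} (h : ρ.PosSemidef) :
    (T.app ρ).PosSemidef :=
  Matrix.posSemidef_sum _ fun _ _ => h.mul_mul_conjTranspose_same _

lemma trace_app (T : Channel α β) (ρ : Matrix α α ℂ) : (T.app ρ).trace = ρ.trace := by
  rw [app, Matrix.trace_sum]
  rw [Finset.sum_congr rfl fun i _ => Matrix.trace_mul_cycle (T.kraus i) ρ (T.kraus i)ᴴ,
    ← Matrix.trace_sum, ← Matrix.sum_mul, T.complete, Matrix.one_mul]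

lemma app_proj (T : Channel α β) (ψ : α → ℂ) :
    T.app (proj ψ) = ∑ i, proj (T.kraus i *ᵥ ψ) := by
  simp [app, mul_proj_mul]

lemma sum_star_dotProduct (T : Channel α β) (ψ φ : α → ℂ) :
    ∑ i, star (T.kraus i *ᵥ ψ) ⬝ᵥ (T.kraus i *ᵥ φ) = star ψ ⬝ᵥ φ := by
  simp only [Matrix.star_mulVec, ← Matrix.dotProduct_mulVec, Matrix.mulVec_mulVec]
  rw [← dotProduct_sum, ← Matrix.sum_mulVec, T.complete, Matrix.one_mulVec]

/-- The operation given by an isometry. -/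
def ofIsometry (V : Matrix β α ℂ) (hV : Vᴴ * V = 1) : Channel α β where
  num := 1
  kraus := fun _ => V
  complete := by simpa using hV

lemma ofIsometry_app (V : Matrix β α ℂ) (hV : Vᴴ * V = 1) (ρ : Matrix α α ℂ) :
    (ofIsometry V hV).app ρ = V * ρ * Vᴴ := by
  exact Fin.sum_univ_one _

end Channel

/-! ### No information gain without disturbance. -/

section Disturbance

variable {P M P' M' : Type} [Fintype P] [Fintype M] [Fintype P'] [Fintype M']

lemma star_prod_dotProduct (s t : P → ℂ) (ψ φ : M → ℂ) :
    star (fun z : P × M => s z.1 * ψ z.2) ⬝ᵥ (fun z : P × M => t z.1 * φ z.2) =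
      (star s ⬝ᵥ t) * (star ψ ⬝ᵥ φ) := by
  simp only [dotProduct, Fintype.sum_prod_type, Finset.sum_mul_sum, Pi.star_apply, star_mul']
  refine Finset.sum_congr rfl fun i _ => Finset.sum_congr rfl fun j _ => ?_
  ring

lemma proj_prod (s : P → ℂ) (ψ : M → ℂ) :
    proj (fun z : P × M => s z.1 * ψ z.2) = proj s ⊗ₖ proj ψ := by
  ext ⟨i, j⟩ ⟨i', j'⟩
  simp only [proj_apply, Matrix.kroneckerMap_apply, star_mul']
  ring

/-- Vectors whose mixture has a pure marginal are products. -/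
lemma eq_prod_of_trFst_eq_proj {κ : Type} [Fintype κ] (w : κ → P × M → ℂ) {φ : M → ℂ}
    (hφ : star φ ⬝ᵥ φ = 1) (h : trFst (∑ k, proj (w k)) = proj φ) (k : κ) (z : P × M) :
    w k z = (∑ m, star (φ m) * w k (z.1, m)) * φ z.2 := by
  set u : κ → P → ℂ := fun k p => ∑ m, star (φ m) * w k (p, m) with hu
  have hm : ∀ m m', ∑ k, ∑ p, w k (p, m) * star (w k (p, m')) = φ m * star (φ m') := by
    intro m m'
    have := congrFun (congrFun h m) m'
    simp only [trFst, Matrix.of_apply, Matrix.sum_apply, proj_apply] at this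
    rw [Finset.sum_comm, this]
  have hφ' : ∑ m, φ m * star (φ m) = 1 := by
    rw [← hφ, dotProduct]
    exact Finset.sum_congr rfl fun m _ => mul_comm _ _
  have hw : ∑ k, ∑ p, ∑ m, w k (p, m) * star (w k (p, m)) = 1 := by
    rw [← hφ', Finset.sum_congr rfl fun k _ => Finset.sum_comm, Finset.sum_comm]
    exact Finset.sum_congr rfl fun m _ => hm m m
  -- The components of the `w k` along `φ` already carry the whole squared norm `1`, because the
  -- marginal has expectation `1` in `φ`. Hence the components orthogonal to `φ` vanish.
  have huu : ∑ k, ∑ p, u k p * star (u k p) = 1 := by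
    have : ∀ k p, u k p * star (u k p) =
        ∑ m, ∑ m', star (φ m) * φ m' * (w k (p, m) * star (w k (p, m'))) := by
      intro k p
      simp only [hu, star_sum, Finset.sum_mul_sum, star_mul', star_star]
      refine Finset.sum_congr rfl fun i _ => Finset.sum_congr rfl fun j _ => ?_
      ring
    simp only [this]
    have e : ∑ k, ∑ p, ∑ m, ∑ m', star (φ m) * φ m' * (w k (p, m) * star (w k (p, m'))) =
        ∑ m, ∑ m', star (φ m) * φ m' * ∑ k, ∑ p, w k (p, m) * star (w k (p, m')) := by
      simp only [Finset.mul_sum]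
      rw [Finset.sum_congr rfl fun k _ => Finset.sum_comm, Finset.sum_comm]
      refine Finset.sum_congr rfl fun m _ => ?_
      rw [Finset.sum_congr rfl fun k _ => Finset.sum_comm, Finset.sum_comm]
    rw [e]
    simp only [hm]
    rw [← mul_one (1 : ℂ), ← hφ', Finset.sum_mul_sum]
    refine Finset.sum_congr rfl fun i _ => Finset.sum_congr rfl fun j _ => ?_
    ring
  have hcross : ∀ k p, ∑ m, w k (p, m) * star (u k p * φ m) = u k p * star (u k p) := by
    intro k p
    conv_rhs => rw [hu]
    simp only [Finset.sum_mul, star_mul']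
    refine Finset.sum_congr rfl fun m _ => ?_
    simp only [hu]
    ring
  have hd : ∑ k, ∑ p, ∑ m,
      (w k (p, m) - u k p * φ m) * star (w k (p, m) - u k p * φ m) = 0 := by
    have : ∀ k p, ∑ m, (w k (p, m) - u k p * φ m) * star (w k (p, m) - u k p * φ m) =
        (∑ m, w k (p, m) * star (w k (p, m))) - u k p * star (u k p) := by
      intro k p
      have h1 := hcross k p
      have h2 := congrArg star h1
      rw [star_sum, star_mul', star_star] at h2
      have h3 : ∑ m, (u k p * φ m) * star (u k p * φ m) = u k p * star (u k p) := by
        rw [← mul_one (u k p * star (u k p)), ← hφ', Finset.mul_sum]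
        refine Finset.sum_congr rfl fun m _ => ?_
        rw [star_mul']; ring
      have h4 : ∑ m, (u k p * φ m) * star (w k (p, m)) = u k p * star (u k p) := by
        rw [mul_comm (u k p), ← h2]
        refine Finset.sum_congr rfl fun m _ => ?_
        rw [star_mul' (w k (p, m)), star_star]; ring
      simp only [star_sub, mul_sub, sub_mul, Finset.sum_sub_distrib]
      rw [h1, h3, h4]
      ring
    simp only [this, Finset.sum_sub_distrib]
    rw [hw, huu, sub_self]
  have hnn : ∀ c : ℂ, 0 ≤ c * star c := fun c => mul_star_self_nonneg c
  have h1 := (Finset.sum_eq_zero_iff_of_nonneg fun k _ => Finset.sum_nonneg fun p _ =>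
    Finset.sum_nonneg fun m _ => hnn _).1 hd k (Finset.mem_univ _)
  have h2 := (Finset.sum_eq_zero_iff_of_nonneg fun p _ =>
    Finset.sum_nonneg fun m _ => hnn _).1 h1 z.1 (Finset.mem_univ _)
  have h3 := (Finset.sum_eq_zero_iff_of_nonneg fun m _ => hnn _).1 h2 z.2 (Finset.mem_univ _)
  have h4 := (mul_eq_zero.1 h3).elim id fun h => star_eq_zero.1 h
  exact sub_eq_zero.1 h4

/-- Whoever has to return pure states, in place of the nonorthogonal pure states with the same
inner products that he received, learns nothing: he is left with a state that does not depend on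
them. -/
theorem exists_app_eq_kronecker [DecidableEq P] [DecidableEq M] {ι : Type} [Nonempty ι]
    (T : Channel (P × M) (P' × M')) {σ : Matrix P P ℂ} (hσ : σ.PosSemidef) (hσ1 : σ.trace = 1)
    (ψ : ι → M → ℂ) (φ : ι → M' → ℂ) (hψ : ∀ x, star (ψ x) ⬝ᵥ ψ x = 1)
    (hne : ∀ x x', star (ψ x) ⬝ᵥ ψ x' ≠ 0)
    (hg : ∀ x x', star (φ x) ⬝ᵥ φ x' = star (ψ x) ⬝ᵥ ψ x')
    (h : ∀ x, trFst (T.app (σ ⊗ₖ proj (ψ x))) = proj (φ x)) :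
    ∃ σ' : Matrix P' P' ℂ, σ'.PosSemidef ∧ σ'.trace = 1 ∧
      ∀ x, T.app (σ ⊗ₖ proj (ψ x)) = σ' ⊗ₖ proj (φ x) := by
  -- The columns of `C` are the eigenvectors of `σ`, scaled by the square roots of the eigenvalues.
  obtain ⟨C, hC⟩ : ∃ C : P → P → ℂ, σ = ∑ a, proj (C a) := by
    refine ⟨fun a p => (hσ.1.eigenvectorUnitary : Matrix P P ℂ) p a *
      (Real.sqrt (hσ.1.eigenvalues a) : ℂ), ?_⟩
    ext i j
    conv_lhs => rw [eq_eigenvectorUnitary_mul hσ.1]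
    rw [Matrix.mul_apply, Matrix.sum_apply]
    refine Finset.sum_congr rfl fun a _ => ?_
    have hsq : (hσ.1.eigenvalues a : ℂ) =
        (Real.sqrt (hσ.1.eigenvalues a) : ℂ) * (Real.sqrt (hσ.1.eigenvalues a) : ℂ) := by
      rw [← Complex.ofReal_mul, Real.mul_self_sqrt (hσ.eigenvalues_nonneg a)]
    rw [Matrix.mul_diagonal, Matrix.conjTranspose_apply, proj_apply, star_mul',
      show star (Real.sqrt (hσ.1.eigenvalues a) : ℂ) = (Real.sqrt (hσ.1.eigenvalues a) : ℂ) from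
        Complex.conj_ofReal _]
    conv_lhs => rw [hsq]
    ring
  set w : ι → Fin T.num × P → P' × M' → ℂ := fun x k =>
    T.kraus k.1 *ᵥ (fun z : P × M => C k.2 z.1 * ψ x z.2) with hw
  have happ : ∀ x, T.app (σ ⊗ₖ proj (ψ x)) = ∑ k, proj (w x k) := by
    intro x
    have : σ ⊗ₖ proj (ψ x) = ∑ a, proj (fun z : P × M => C a z.1 * ψ x z.2) := by
      simp only [proj_prod]
      rw [hC]
      ext ⟨i, j⟩ ⟨i', j'⟩
      simp [Matrix.sum_apply, Finset.sum_mul]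
    rw [this, Channel.app_sum, Fintype.sum_prod_type, Finset.sum_comm]
    exact Finset.sum_congr rfl fun a _ => T.app_proj _
  set u : ι → Fin T.num × P → P' → ℂ := fun x k p => ∑ m, star (φ x m) * w x k (p, m) with hu
  have hφ : ∀ x, star (φ x) ⬝ᵥ φ x = 1 := fun x => (hg x x).trans (hψ x)
  have hwu : ∀ x k, w x k = fun z => u x k z.1 * φ x z.2 := by
    intro x k
    ext z
    exact eq_prod_of_trFst_eq_proj (w x) (hφ x) (by rw [← happ]; exact h x) k z
  -- Completeness of the Kraus operators preserves inner products after summation over `i`. The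
  -- factor `⟨ψ x, ψ x'⟩ = ⟨φ x, φ x'⟩` can be cancelled because it is nonzero; this is where
  -- nonorthogonality enters.
  have hinner : ∀ x x' a, ∑ i, star (u x (i, a)) ⬝ᵥ u x' (i, a) = star (C a) ⬝ᵥ C a := by
    intro x x' a
    have h1 := T.sum_star_dotProduct (fun z : P × M => C a z.1 * ψ x z.2)
      (fun z : P × M => C a z.1 * ψ x' z.2)
    rw [star_prod_dotProduct] at h1
    have h2 : ∀ i, star (T.kraus i *ᵥ fun z : P × M => C a z.1 * ψ x z.2) ⬝ᵥ
        (T.kraus i *ᵥ fun z : P × M => C a z.1 * ψ x' z.2) =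
        (star (u x (i, a)) ⬝ᵥ u x' (i, a)) * (star (ψ x) ⬝ᵥ ψ x') := by
      intro i
      rw [← hg, ← star_prod_dotProduct, ← hwu, ← hwu]
    simp only [h2] at h1
    rw [← Finset.sum_mul] at h1
    exact mul_right_cancel₀ (hne x x') h1
  -- All the summed inner products equal the same number, the squared norm of `C a`, so `∑ i ‖u x -
  -- u x'‖² = 0`.
  have huu : ∀ x x' k, u x k = u x' k := by
    rintro x x' ⟨i, a⟩
    have h1 : ∑ i, star (u x (i, a) - u x' (i, a)) ⬝ᵥ (u x (i, a) - u x' (i, a)) = 0 := by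
      simp only [star_sub, sub_dotProduct, dotProduct_sub, Finset.sum_sub_distrib, hinner]
      ring
    have h2 := (Finset.sum_eq_zero_iff_of_nonneg fun i _ =>
      dotProduct_star_self_nonneg _).1 h1 i (Finset.mem_univ _)
    exact sub_eq_zero.1 (dotProduct_star_self_eq_zero.1 h2)
  obtain ⟨x₀⟩ := ‹Nonempty ι›
  have hres : ∀ x, T.app (σ ⊗ₖ proj (ψ x)) = (∑ k, proj (u x₀ k)) ⊗ₖ proj (φ x) := by
    intro x
    rw [happ]
    simp only [hwu, proj_prod, huu x x₀]
    ext ⟨i, j⟩ ⟨i', j'⟩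
    simp [Matrix.sum_apply, Finset.sum_mul]
  refine ⟨∑ k, proj (u x₀ k), Matrix.posSemidef_sum _ fun k _ => posSemidef_proj _, ?_, hres⟩
  have h1 := congrArg Matrix.trace (hres x₀)
  rw [Channel.trace_app, Matrix.trace_kronecker, Matrix.trace_kronecker, trace_proj, trace_proj,
    hφ, hψ, hσ1, mul_one, mul_one] at h1
  exact h1.symm

end Disturbance

/-! ### Domination by a maximally mixed message. -/

section Domination

variable {P M O : Type} [Fintype P] [Fintype M] [Fintype O]

lemma trFst_pass (ρ : Matrix ((P × M) × O) ((P × M) × O) ℂ) :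
    trFst (pass ρ) = trSnd (trSnd ρ) := by
  ext i j
  simp only [trFst, trSnd, pass, Matrix.of_apply, Matrix.submatrix_apply, Fintype.sum_prod_type]
  rw [Finset.sum_comm]

lemma trSnd_pass_kronecker (ρ : Matrix (P × M) (P × M) ℂ) (c : Matrix O O ℂ) :
    trSnd (pass (ρ ⊗ₖ c)) = c ⊗ₖ trFst ρ := by
  ext ⟨o, m⟩ ⟨o', m'⟩
  simp [trSnd, pass, trFst, Finset.mul_sum, mul_comm]

variable [DecidableEq P] [DecidableEq M]

lemma posSemidef_trFst {a : Matrix (P × M) (P × M) ℂ} (h : a.PosSemidef) :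
    (trFst a).PosSemidef := by
  have : trFst a = ∑ p, a.submatrix (fun m => (p, m)) (fun m => (p, m)) := by
    ext i j
    simp [trFst, Matrix.sum_apply]
  rw [this]
  exact Matrix.posSemidef_sum _ fun m _ => h.submatrix _

lemma trace_trFst (a : Matrix (P × M) (P × M) ℂ) : (trFst a).trace = a.trace := by
  simp only [trFst, Matrix.trace, Fintype.sum_prod_type, Matrix.diag, Matrix.of_apply]
  rw [Finset.sum_comm]

lemma posSemidef_one_sub {ρ : Matrix M M ℂ} (h : ρ.PosSemidef) (h1 : ρ.trace = 1) :
    (1 - ρ).PosSemidef := by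
  have hs := trace_eq_sum_eigenvalues_real h.1 (q := 1) (by simpa using h1)
  have : 1 - ρ = (h.1.eigenvectorUnitary : Matrix M M ℂ) *
      Matrix.diagonal (fun i => ((1 - h.1.eigenvalues i : ℝ) : ℂ)) *
      (h.1.eigenvectorUnitary : Matrix M M ℂ)ᴴ := by
    have e : Matrix.diagonal (fun i => ((1 - h.1.eigenvalues i : ℝ) : ℂ)) =
        1 - Matrix.diagonal (fun i => (h.1.eigenvalues i : ℂ)) := by
      rw [← Matrix.diagonal_one, Matrix.diagonal_sub]
      congr 1
      ext i
      simp
    rw [e, Matrix.mul_sub, Matrix.sub_mul, Matrix.mul_one,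
      eigenvectorUnitary_mul_conjTranspose, ← eq_eigenvectorUnitary_mul h.1]
  rw [this]
  refine (Matrix.PosSemidef.diagonal fun i => ?_).mul_mul_conjTranspose_same _
  have h2 : h.1.eigenvalues i ≤ 1 := hs ▸
    Finset.single_le_sum (fun i _ => h.eigenvalues_nonneg i) (Finset.mem_univ i)
  change (0 : ℂ) ≤ ((1 - h.1.eigenvalues i : ℝ) : ℂ)
  rw [Complex.zero_le_real]
  linarith

/-- The maximally mixed state. -/
def mixed (M : Type) [Fintype M] [DecidableEq M] : Matrix M M ℂ := (Fintype.card M : ℂ)⁻¹ • 1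

lemma posSemidef_mixed : (mixed M).PosSemidef :=
  Matrix.PosSemidef.one.smul (by positivity)

lemma trace_mixed [Nonempty M] : (mixed M).trace = 1 := by
  simp [mixed]

lemma card_smul_mixed [Nonempty M] : (Fintype.card M : ℂ) • mixed M = 1 := by
  simp [mixed, smul_smul]

lemma posSemidef_smul_kronecker_mixed_sub [Nonempty M] {σ : Matrix P P ℂ} {ρ : Matrix M M ℂ}
    (hσ : σ.PosSemidef) (hρ : ρ.PosSemidef) (hρ1 : ρ.trace = 1) :
    ((Fintype.card M : ℂ) • (σ ⊗ₖ mixed M) - σ ⊗ₖ ρ).PosSemidef := by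
  have : (Fintype.card M : ℂ) • (σ ⊗ₖ mixed M) - σ ⊗ₖ ρ = σ ⊗ₖ (1 - ρ) := by
    rw [← Matrix.kronecker_smul, card_smul_mixed]
    ext ⟨i, j⟩ ⟨i', j'⟩
    simp [mul_sub]
  rw [this]
  exact hσ.kronecker (posSemidef_one_sub hρ hρ1)

variable {X Y Z : Type} [Fintype X] [DecidableEq X] [Fintype Y] [DecidableEq Y]
  [Fintype Z] [DecidableEq Z]

lemma divulged_le_of_eq (f : X → Y → Z) {μ : X × Y → ℝ} (hμ : μ ∈ stdSimplex ℝ (X × Y))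
    {τ : Y → Matrix P P ℂ} {D : ℝ} (hD : 1 ≤ D)
    (hτ : ∀ y, (τ y).PosSemidef) (hτ1 : ∀ y, (τ y).trace = 1) :
    divulged f μ (fun _ y => τ y) ≤ Real.logb 2 D := by
  refine divulged_le f hμ hD (fun _ => hτ) (fun _ => hτ1) hτ hτ1 fun _ y => ?_
  have : (D : ℂ) • τ y - τ y = ((D - 1 : ℝ) : ℂ) • τ y := by
    push_cast
    rw [sub_smul, one_smul]
  rw [this]
  exact (hτ y).smul (by rw [Complex.zero_le_real]; linarith)

/-- A state is at most the identity, so `σ y ⊗ ρ x y` lies below `card M` times `σ y ⊗ mixed`. The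
product form matters: it lets the dimension of the message alone enter, however large the private
register is. -/
lemma divulged_kronecker_le [Nonempty M] (f : X → Y → Z) {μ : X × Y → ℝ}
    (hμ : μ ∈ stdSimplex ℝ (X × Y)) {σ : Y → Matrix P P ℂ} {ρ : X → Y → Matrix M M ℂ}
    (hσ : ∀ y, (σ y).PosSemidef) (hσ1 : ∀ y, (σ y).trace = 1)
    (hρ : ∀ x y, (ρ x y).PosSemidef) (hρ1 : ∀ x y, (ρ x y).trace = 1) :
    divulged f μ (fun x y => σ y ⊗ₖ ρ x y) ≤ Real.logb 2 (Fintype.card M) := by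
  refine divulged_le f hμ (τ := fun y => σ y ⊗ₖ mixed M) ?_
    (fun x y => (hσ y).kronecker (hρ x y))
    (fun x y => by rw [Matrix.trace_kronecker, hσ1, hρ1, mul_one])
    (fun y => (hσ y).kronecker posSemidef_mixed)
    (fun y => by rw [Matrix.trace_kronecker, hσ1, trace_mixed, mul_one])
    (fun x y => ?_)
  · exact_mod_cast Fintype.card_pos
  · exact_mod_cast posSemidef_smul_kronecker_mixed_sub (hσ y) (hρ x y) (hρ1 x y)

/-- Positive maps preserve the domination, so whatever is done locally with the message, and
whatever part is then sent away, the bound stays the same. -/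
lemma divulged_trSnd_app_le [Nonempty M] (f : X → Y → Z) {μ : X × Y → ℝ}
    (hμ : μ ∈ stdSimplex ℝ (X × Y)) {Q N : Type} [Fintype Q] [DecidableEq Q] [Fintype N]
    (T : Y → Channel (P × M) (Q × N)) {σ : Y → Matrix P P ℂ} {ρ : X → Y → Matrix M M ℂ}
    (hσ : ∀ y, (σ y).PosSemidef) (hσ1 : ∀ y, (σ y).trace = 1)
    (hρ : ∀ x y, (ρ x y).PosSemidef) (hρ1 : ∀ x y, (ρ x y).trace = 1) :
    divulged f μ (fun x y => trSnd ((T y).app (σ y ⊗ₖ ρ x y))) ≤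
      Real.logb 2 (Fintype.card M) := by
  refine divulged_le f hμ (τ := fun y => trSnd ((T y).app (σ y ⊗ₖ mixed M))) ?_
    (fun x y => posSemidef_trSnd ((T y).posSemidef_app ((hσ y).kronecker (hρ x y))))
    (fun x y => by
      rw [trace_trSnd, Channel.trace_app, Matrix.trace_kronecker, hσ1, hρ1, mul_one])
    (fun y => posSemidef_trSnd ((T y).posSemidef_app ((hσ y).kronecker posSemidef_mixed)))
    (fun y => by
      rw [trace_trSnd, Channel.trace_app, Matrix.trace_kronecker, hσ1, trace_mixed, mul_one])
    (fun x y => ?_)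
  · exact_mod_cast Fintype.card_pos
  · rw [← trSnd_smul, ← Channel.app_smul, ← trSnd_sub, ← Channel.app_sub]
    refine posSemidef_trSnd ((T y).posSemidef_app ?_)
    exact_mod_cast posSemidef_smul_kronecker_mixed_sub (hσ y) (hρ x y) (hρ1 x y)

lemma pass_act_eq {P' M' : Type} [Fintype P'] [Fintype M'] [DecidableEq O]
    {T : Channel (P × M) (P' × M')} {ρ : Matrix ((P × M) × O) ((P × M) × O) ℂ}
    {a : Matrix P P ℂ} {b : Matrix M M ℂ} {c : Matrix O O ℂ} {a' : Matrix P' P' ℂ}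
    {b' : Matrix M' M' ℂ} (hρ : ρ = (a ⊗ₖ b) ⊗ₖ c) (hT : T.app (a ⊗ₖ b) = a' ⊗ₖ b') :
    pass (T.act ρ) = (c ⊗ₖ b') ⊗ₖ a' := by
  rw [hρ, Channel.act_kronecker, hT, pass_kronecker]

lemma trFst_trSnd_eq {ρ : Matrix ((P × M) × O) ((P × M) × O) ℂ}
    {a : Matrix P P ℂ} {b : Matrix M M ℂ} {c : Matrix O O ℂ} (hρ : ρ = (a ⊗ₖ b) ⊗ₖ c)
    (ha : a.trace = 1) (hc : c.trace = 1) : trFst (trSnd ρ) = b := by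
  rw [hρ, trSnd_kronecker, hc, one_smul, trFst_kronecker, ha, one_smul]

lemma trFst_trSnd_pass_act {P' M' : Type} [Fintype P'] [Fintype M'] [DecidableEq O]
    (T : Channel (P × M) (P' × M')) {ρ : Matrix ((P × M) × O) ((P × M) × O) ℂ}
    {r : Matrix (P × M) (P × M) ℂ} {c : Matrix O O ℂ} (hρ : ρ = r ⊗ₖ c) (hc : c.trace = 1) :
    trFst (trSnd (pass (T.act ρ))) = trFst (T.app r) := by
  rw [hρ, Channel.act_kronecker, trSnd_pass_kronecker, trFst_kronecker, hc, one_smul]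

lemma trFst_pass_act {P' M' : Type} [Fintype P'] [Fintype M'] [DecidableEq O]
    (T : Channel (P × M) (P' × M')) {ρ : Matrix ((P × M) × O) ((P × M) × O) ℂ}
    {r : Matrix (P × M) (P × M) ℂ} {c : Matrix O O ℂ} (hρ : ρ = r ⊗ₖ c) (hc : c.trace = 1) :
    trFst (pass (T.act ρ)) = trSnd (T.app r) := by
  rw [hρ, Channel.act_kronecker, trFst_pass, trSnd_kronecker, hc, one_smul]

lemma trSnd_pass_act {P' M' : Type} [Fintype P'] [Fintype M'] [DecidableEq O]
    (T : Channel (P × M) (P' × M')) {ρ : Matrix ((P × M) × O) ((P × M) × O) ℂ}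
    {r : Matrix (P × M) (P × M) ℂ} {c : Matrix O O ℂ} (hρ : ρ = r ⊗ₖ c) :
    trSnd (pass (T.act ρ)) = c ⊗ₖ trFst (T.app r) := by
  rw [hρ, Channel.act_kronecker, trSnd_pass_kronecker]

end Domination

/-! ### Protocols that pass a pure register to and fro. -/

/-- Data for a protocol in which a register of `q` qubits is sent to and fro, so that all messages
but the last one are pure states. -/
structure PingPong (X Y Z : Type) (q : ℕ) where
  /-- The number of times Bob applies `opBob` before his last turn. -/
  turns : ℕ
  init : X → Reg q → ℂ
  init_unit : ∀ x, star (init x) ⬝ᵥ init x = 1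
  opAl : ℕ → X → Matrix (Reg q) (Reg q) ℂ
  opAl_isometry : ∀ k x, (opAl k x)ᴴ * opAl k x = 1
  opBob : Y → Matrix (Reg q) (Reg q) ℂ
  opBob_isometry : ∀ y, (opBob y)ᴴ * opBob y = 1
  /-- Bob's last operation, which permutes the basis states of a private qubit and the message. -/
  final : Y → Equiv.Perm (Reg 1 × Reg q)
  outAl : Reg q → Z
  outBob : Reg 1 → Z

namespace PingPong

variable {X Y Z : Type} {q : ℕ} (S : PingPong X Y Z q)

/-- The message of Al in his turn `k`. -/
def msg (x : X) (y : Y) : ℕ → Reg q → ℂ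
  | 0 => S.init x
  | k + 1 => S.opAl k x *ᵥ (S.opBob y *ᵥ msg x y k)

lemma msg_unit (x : X) (y : Y) (k : ℕ) : star (S.msg x y k) ⬝ᵥ S.msg x y k = 1 := by
  induction k with
  | zero => exact S.init_unit x
  | succ k ih =>
    rw [msg, star_mulVec_dotProduct_mulVec (S.opAl_isometry k x),
      star_mulVec_dotProduct_mulVec (S.opBob_isometry y), ih]

/-- The sizes of the messages of Bob. -/
def backSize (q : ℕ) : ℕ → ℕ
  | 0 => 0
  | _ + 1 => q

lemma one_kronecker_isometry {P M : Type} [Fintype P] [DecidableEq P] [Fintype M] [DecidableEq M]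
    {V : Matrix M M ℂ} (h : Vᴴ * V = 1) :
    ((1 : Matrix P P ℂ) ⊗ₖ V)ᴴ * ((1 : Matrix P P ℂ) ⊗ₖ V) = 1 := by
  rw [Matrix.conjTranspose_kronecker, ← Matrix.mul_kronecker_mul, h]
  simp

/-- The operation by which Al prepares the first message. -/
def initOp (x : X) : Channel (Reg 0 × Reg 0) (Reg 0 × Reg q) :=
  Channel.ofIsometry (Matrix.of fun i _ => S.init x i.2) <| by
    ext i j
    rw [Subsingleton.elim i j, Matrix.one_apply_eq, ← S.init_unit x, Matrix.mul_apply,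
      Fintype.sum_prod_type, Fintype.sum_unique]
    rfl

/-- The operation of Al in his turn `k + 1`. -/
def stepOp (k : ℕ) (x : X) : Channel (Reg 0 × Reg q) (Reg 0 × Reg q) :=
  Channel.ofIsometry ((1 : Matrix (Reg 0) (Reg 0) ℂ) ⊗ₖ S.opAl k x)
    (one_kronecker_isometry (S.opAl_isometry k x))

/-- The operations of Al. -/
def alOp : (k : ℕ) → X → Channel (Reg 0 × Reg (backSize q k)) (Reg 0 × Reg q)
  | 0, x => S.initOp x
  | k + 1, x => S.stepOp k x

/-- The matrix of Bob's last operation. -/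
def finalMatrix (y : Y) : Matrix (Reg 1 × Reg q) (Reg 1 × Reg q) ℂ :=
  (1 : Matrix (Reg 1 × Reg q) (Reg 1 × Reg q) ℂ).submatrix (S.final y).symm (Equiv.refl _)

lemma finalMatrix_isometry (y : Y) : (S.finalMatrix y)ᴴ * S.finalMatrix y = 1 := by
  rw [finalMatrix, Matrix.conjTranspose_submatrix, Matrix.conjTranspose_one,
    Matrix.submatrix_mul_equiv, Matrix.one_mul]
  rfl

lemma finalMatrix_mulVec (y : Y) (ψ : Reg 1 × Reg q → ℂ) (i : Reg 1 × Reg q) :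
    (S.finalMatrix y *ᵥ ψ) i = ψ ((S.final y).symm i) := by
  simp [finalMatrix, Matrix.mulVec, dotProduct, Matrix.one_apply]

/-- The operations of Bob. -/
def bobOp (k : ℕ) (y : Y) : Channel (Reg 1 × Reg q) (Reg 1 × Reg q) :=
  if k = S.turns then Channel.ofIsometry (S.finalMatrix y) (S.finalMatrix_isometry y)
  else Channel.ofIsometry ((1 : Matrix (Reg 1) (Reg 1) ℂ) ⊗ₖ S.opBob y)
      (one_kronecker_isometry (S.opBob_isometry y))

/-- The protocol. -/
def protocol : Protocol X Y Z where
  rounds := S.turns + 1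
  qA := fun _ => q
  qB := backSize q
  qB_zero := rfl
  al := { priv := fun _ => 0, op := S.alOp }
  bob := { priv := fun _ => 1, op := S.bobOp }
  al_unitary := fun k x => by cases k <;> rfl
  bob_unitary := fun k y => by
    change (S.bobOp k y).num = 1
    unfold bobOp
    split_ifs <;> rfl
  outAl := fun i => S.outAl i.2
  outBob := S.outBob

lemma communication_protocol : S.protocol.communication = (S.turns + 1) * (q + q) := by
  change ∑ k ∈ Finset.range (S.turns + 1), (q + q) = _
  simp

lemma run_zero {qA qB : ℕ → ℕ} (A : Strategy X qB qA) (B : Strategy Y qA fun k => qB (k + 1))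
    (x : X) (y : Y) :
    run A B x y 0 = (Matrix.single 0 0 1 ⊗ₖ Matrix.single 0 0 1) ⊗ₖ Matrix.single 0 0 1 := by
  rw [run, Matrix.single_kronecker_single, Matrix.single_kronecker_single, mul_one, mul_one]
  rfl

lemma single_reg_zero : Matrix.single (0 : Reg 0) (0 : Reg 0) (1 : ℂ) = 1 := by
  ext i j
  rw [Subsingleton.elim i 0, Subsingleton.elim j 0]
  simp

lemma trace_one_reg_zero : (1 : Matrix (Reg 0) (Reg 0) ℂ).trace = 1 := by
  simp

lemma trace_single_self {A : Type} [Fintype A] [DecidableEq A] (a : A) :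
    (Matrix.single a a (1 : ℂ)).trace = 1 := by
  simp

lemma posSemidef_single_self {A : Type} [Fintype A] [DecidableEq A] (a : A) :
    (Matrix.single a a (1 : ℂ)).PosSemidef := by
  rw [single_zero_eq_proj]
  exact posSemidef_proj _

lemma initOp_app (x : X) :
    (S.initOp x).app (Matrix.single (0 : Reg 0) (0 : Reg 0) 1 ⊗ₖ
      Matrix.single (0 : Reg 0) (0 : Reg 0) 1) = 1 ⊗ₖ proj (S.init x) := by
  rw [initOp, Channel.ofIsometry_app, single_zero_eq_proj, ← proj_prod, mul_proj_mul,
    ← single_reg_zero, single_zero_eq_proj, ← proj_prod]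
  congr 1
  ext i
  rw [Matrix.mulVec, dotProduct, Fintype.sum_subsingleton _ (0, 0), Subsingleton.elim i.1 0]
  simp only [Matrix.of_apply, Pi.single_eq_same, mul_one, one_mul]

lemma stepOp_app (k : ℕ) (x : X) (ψ : Reg q → ℂ) :
    (S.stepOp k x).app ((1 : Matrix (Reg 0) (Reg 0) ℂ) ⊗ₖ proj ψ) =
      1 ⊗ₖ proj (S.opAl k x *ᵥ ψ) := by
  rw [stepOp, Channel.ofIsometry_app, Matrix.conjTranspose_kronecker,
    ← Matrix.mul_kronecker_mul, ← Matrix.mul_kronecker_mul, mul_proj_mul]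
  simp

lemma bobOp_app {k : ℕ} (hk : k < S.turns) (y : Y) (ρ : Matrix (Reg 1) (Reg 1) ℂ)
    (ψ : Reg q → ℂ) :
    (S.bobOp k y).app (ρ ⊗ₖ proj ψ) = ρ ⊗ₖ proj (S.opBob y *ᵥ ψ) := by
  rw [bobOp, if_neg hk.ne, Channel.ofIsometry_app, Matrix.conjTranspose_kronecker,
    ← Matrix.mul_kronecker_mul, ← Matrix.mul_kronecker_mul, mul_proj_mul]
  simp

lemma runMid_zero_bob (B : Strategy Y S.protocol.qA fun k => S.protocol.qB (k + 1))
    (x : X) (y : Y) :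
    runMid S.protocol.al B x y 0 =
      (Matrix.single 0 0 1 ⊗ₖ proj (S.msg x y 0)) ⊗ₖ (1 : Matrix (Reg 0) (Reg 0) ℂ) :=
  pass_act_eq (T := S.initOp x) (run_zero _ B x y) (S.initOp_app x)

lemma runMid_succ_bob (B : Strategy Y S.protocol.qA fun k => S.protocol.qB (k + 1))
    (x : X) (y : Y) (k : ℕ) {σ : Matrix (Reg (B.priv (k + 1))) (Reg (B.priv (k + 1))) ℂ}
    (h : run S.protocol.al B x y (k + 1) =
      ((1 : Matrix (Reg 0) (Reg 0) ℂ) ⊗ₖ proj (S.opBob y *ᵥ S.msg x y k)) ⊗ₖ σ) :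
    runMid S.protocol.al B x y (k + 1) =
      (σ ⊗ₖ proj (S.msg x y (k + 1))) ⊗ₖ (1 : Matrix (Reg 0) (Reg 0) ℂ) :=
  pass_act_eq (T := S.stepOp k x) h (S.stepOp_app k x _)

/-- The initial state of Bob's private qubit. -/
def bobZero : Matrix (Reg 1) (Reg 1) ℂ := Matrix.single 0 0 1

lemma runMid_honest (x : X) (y : Y) {k : ℕ} (hk : k ≤ S.turns) :
    runMid S.protocol.al S.protocol.bob x y k =
      (bobZero ⊗ₖ proj (S.msg x y k)) ⊗ₖ (1 : Matrix (Reg 0) (Reg 0) ℂ) := by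
  induction k with
  | zero => exact S.runMid_zero_bob _ x y
  | succ k ih =>
    exact S.runMid_succ_bob _ x y k
      (pass_act_eq (T := S.bobOp k y) (ih (by omega)) (S.bobOp_app (by omega) y _ _))

lemma msgAl_honest (x : X) (y : Y) {k : ℕ} (hk : k ≤ S.turns) :
    msgAl S.protocol.al S.protocol.bob x y k = proj (S.msg x y k) :=
  trFst_trSnd_eq (S.runMid_honest x y hk) (trace_single_self _) trace_one_reg_zero

lemma msgBob_honest (x : X) (y : Y) {k : ℕ} (hk : k < S.turns) :
    msgBob S.protocol.al S.protocol.bob x y k = proj (S.opBob y *ᵥ S.msg x y k) :=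
  trFst_trSnd_eq (pass_act_eq (T := S.bobOp k y) (S.runMid_honest x y hk.le)
    (S.bobOp_app hk y _ _)) trace_one_reg_zero (trace_single_self _)

/-- Induction over the turns: if Bob's private state is a function of `y` alone, then the
disturbance theorem, applied for fixed `y` to the family of messages indexed by `x`, reproduces this
after his next honest turn. -/
lemma exists_runMid_bob [Nonempty X] (B : Strategy Y S.protocol.qA fun k => S.protocol.qB (k + 1))
    (hne : ∀ k < S.turns, ∀ x x' y, star (S.msg x y k) ⬝ᵥ S.msg x' y k ≠ 0)
    (k : ℕ) (hk : k ≤ S.turns) (hB : S.protocol.HonestBob B k) :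
    ∃ σ : Y → Matrix (Reg (B.priv k)) (Reg (B.priv k)) ℂ,
      (∀ y, (σ y).PosSemidef) ∧ (∀ y, (σ y).trace = 1) ∧
      ∀ x y, runMid S.protocol.al B x y k =
        (σ y ⊗ₖ proj (S.msg x y k)) ⊗ₖ (1 : Matrix (Reg 0) (Reg 0) ℂ) := by
  induction k with
  | zero =>
    exact ⟨fun _ => Matrix.single 0 0 1, fun _ => posSemidef_single_self _,
      fun _ => trace_single_self _, fun x y => S.runMid_zero_bob B x y⟩
  | succ k ih =>
    obtain ⟨σ, hσ, hσ1, h⟩ := ih (by omega) fun x y j hj => hB x y j (by omega)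
    have key := fun y => exists_app_eq_kronecker (B.op k y) (hσ y) (hσ1 y)
      (fun x => S.msg x y k) (fun x => S.opBob y *ᵥ S.msg x y k)
      (fun x => S.msg_unit x y k) (fun x x' => hne k (by omega) x x' y)
      (fun x x' => star_mulVec_dotProduct_mulVec (S.opBob_isometry y) _ _)
      (fun x => by
        have h1 := hB x y k (by omega)
        rw [S.msgBob_honest x y (by omega)] at h1
        exact (trFst_trSnd_pass_act (B.op k y) (h x y) trace_one_reg_zero).symm.trans h1)
    choose σ' hσ' hσ1' h' using key
    exact ⟨σ', hσ', hσ1', fun x y => S.runMid_succ_bob B x y k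
      (pass_act_eq (T := B.op k y) (h x y) (h' y x))⟩

/-- The counterpart for Al: `x` is fixed, and the states that he receives form a family indexed by
`y`. -/
lemma exists_runMid_al [Nonempty Y] (A : Strategy X S.protocol.qB S.protocol.qA)
    (hne : ∀ k < S.turns, ∀ x y y',
      star (S.opBob y *ᵥ S.msg x y k) ⬝ᵥ (S.opBob y' *ᵥ S.msg x y' k) ≠ 0)
    (k : ℕ) (hk : k ≤ S.turns) (hA : S.protocol.HonestAl A (k + 1)) :
    ∃ σ : X → Matrix (Reg (A.priv (k + 1))) (Reg (A.priv (k + 1))) ℂ,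
      (∀ x, (σ x).PosSemidef) ∧ (∀ x, (σ x).trace = 1) ∧
      ∀ x y, runMid A S.protocol.bob x y k =
        (bobZero ⊗ₖ proj (S.msg x y k)) ⊗ₖ σ x := by
  induction k with
  | zero =>
    -- Before his first turn Al has received an empty message. It is treated as a constant family of
    -- unit vectors, so that the disturbance theorem covers the preparation of the first message
    -- too.
    have h0 : ∀ x y, run A S.protocol.bob x y 0 =
        (Matrix.single 0 0 1 ⊗ₖ proj (fun _ : Reg 0 => (1 : ℂ))) ⊗ₖ bobZero := by
      intro x y
      have e : proj (fun _ : Reg 0 => (1 : ℂ)) = Matrix.single (0 : Reg 0) (0 : Reg 0) 1 := by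
        ext i j
        rw [Subsingleton.elim i 0, Subsingleton.elim j 0]
        simp [proj_apply]
      rw [e]
      exact run_zero A _ x y
    have hone : star (fun _ : Reg 0 => (1 : ℂ)) ⬝ᵥ (fun _ : Reg 0 => (1 : ℂ)) = 1 := by
      simp [dotProduct]
    have key := fun x => exists_app_eq_kronecker (ι := Y) (A.op 0 x)
      (posSemidef_single_self (0 : Reg (A.priv 0))) (trace_single_self _)
      (fun _ => fun _ : Reg 0 => (1 : ℂ)) (fun _ => S.init x)
      (fun _ => hone) (fun _ _ => hone.trans_ne one_ne_zero)
      (fun _ _ => (S.init_unit x).trans hone.symm)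
      (fun y => by
        have h1 := hA x y 0 (by omega)
        rw [S.msgAl_honest x y (by omega)] at h1
        exact (trFst_trSnd_pass_act (A.op 0 x) (h0 x y) (trace_single_self _)).symm.trans h1)
    choose σ' hσ' hσ1' h' using key
    exact ⟨σ', hσ', hσ1', fun x y => pass_act_eq (T := A.op 0 x) (h0 x y) (h' x y)⟩
  | succ k ih =>
    obtain ⟨σ, hσ, hσ1, h⟩ := ih (by omega) fun x y j hj => hA x y j (by omega)
    have hrun : ∀ x y, run A S.protocol.bob x y (k + 1) =
        (σ x ⊗ₖ proj (S.opBob y *ᵥ S.msg x y k)) ⊗ₖ bobZero := fun x y =>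
      pass_act_eq (T := S.bobOp k y) (h x y) (S.bobOp_app (by omega) y _ _)
    have key := fun x => exists_app_eq_kronecker (A.op (k + 1) x) (hσ x) (hσ1 x)
      (fun y => S.opBob y *ᵥ S.msg x y k) (fun y => S.msg x y (k + 1))
      (fun y => (star_mulVec_dotProduct_mulVec (S.opBob_isometry y) _ _).trans
        (S.msg_unit x y k))
      (fun y y' => hne k (by omega) x y y')
      (fun y y' => star_mulVec_dotProduct_mulVec (S.opAl_isometry k x) _ _)
      (fun y => by
        have h1 := hA x y (k + 1) (by omega)
        rw [S.msgAl_honest x y hk] at h1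
        exact (trFst_trSnd_pass_act (A.op (k + 1) x) (hrun x y)
          (trace_single_self _)).symm.trans h1)
    choose σ' hσ' hσ1' h' using key
    exact ⟨σ', hσ', hσ1', fun x y => pass_act_eq (T := A.op (k + 1) x) (hrun x y) (h' x y)⟩

lemma card_reg (k : ℕ) : Fintype.card (Reg k) = 2 ^ k := by
  simp [Reg]

lemma logb_card_reg (k : ℕ) : Real.logb 2 (Fintype.card (Reg k)) = k := by
  rw [card_reg]
  push_cast
  rw [Real.logb_pow, Real.logb_self_eq_one (by norm_num), mul_one]

lemma one_le_card_reg (k : ℕ) : (1 : ℝ) ≤ Fintype.card (Reg k) := by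
  exact_mod_cast Fintype.card_pos

/-- At each time the player holds a product of a state that depends on his own input only with a
message of at most `q` qubits, or the result of his own operation on such a product. Right after
sending, Al holds no message at all. -/
theorem privacyLossLE [Fintype X] [DecidableEq X] [Nonempty X] [Fintype Y] [DecidableEq Y]
    [Nonempty Y] [Fintype Z] [DecidableEq Z] (f : X → Y → Z)
    (hneB : ∀ k < S.turns, ∀ x x' y, star (S.msg x y k) ⬝ᵥ S.msg x' y k ≠ 0)
    (hneA : ∀ k < S.turns, ∀ x y y',
      star (S.opBob y *ᵥ S.msg x y k) ⬝ᵥ (S.opBob y' *ᵥ S.msg x y' k) ≠ 0) :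
    S.protocol.PrivacyLossLE f q := by
  intro μ hμ
  have hμ' : (fun p : Y × X => μ p.swap) ∈ stdSimplex ℝ (Y × X) := by
    refine ⟨fun p => hμ.1 _, ?_⟩
    rw [← hμ.2]
    exact (Equiv.prodComm Y X).sum_comp μ
  have hproj : ∀ k x y, (proj (S.msg x y k)).trace = 1 := fun k x y =>
    (trace_proj _).trans (S.msg_unit x y k)
  rw [← logb_card_reg q]
  refine ⟨fun A k => ⟨fun hk hA => ?_, fun hk hA => ?_⟩,
    fun B k => ⟨fun hk hB => ?_, fun hk hB => ?_⟩⟩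
  · cases k with
    | zero =>
      have h : ∀ x y, trSnd (run A S.protocol.bob x y 0) = Matrix.single 0 0 1 := by
        intro x y
        rw [run_zero, trSnd_kronecker, trace_single_self, one_smul,
          Matrix.single_kronecker_single, mul_one]
        rfl
      simp only [h]
      exact divulged_le_of_eq (τ := fun _ => Matrix.single 0 0 1) _ hμ' (one_le_card_reg q)
        (fun _ => posSemidef_single_self _) (fun _ => trace_single_self _)
    | succ k =>
      obtain ⟨σ, hσ, hσ1, h⟩ := S.exists_runMid_al A hneA k (Nat.le_of_succ_le_succ hk) hA
      have h1 : ∀ x y, trSnd (run A S.protocol.bob x y (k + 1)) =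
          σ x ⊗ₖ trFst ((S.bobOp k y).app (bobZero ⊗ₖ proj (S.msg x y k))) := fun x y =>
        trSnd_pass_act (S.bobOp k y) (h x y)
      have h2 := divulged_kronecker_le (fun y x => f x y) hμ' (σ := σ)
        (ρ := fun y x => trFst ((S.bobOp k y).app (bobZero ⊗ₖ proj (S.msg x y k)))) hσ hσ1
        (fun y x => posSemidef_trFst ((S.bobOp k y).posSemidef_app
          ((posSemidef_single_self _).kronecker (posSemidef_proj _))))
        (fun y x => by
          rw [trace_trFst, Channel.trace_app, Matrix.trace_kronecker, hproj, mul_one]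
          exact trace_single_self _)
      have h3 : (fun y x => trSnd (run A S.protocol.bob x y (k + 1))) = fun y x =>
          σ x ⊗ₖ trFst ((S.bobOp k y).app (bobZero ⊗ₖ proj (S.msg x y k))) := by
        ext1 y; ext1 x; exact h1 x y
      rw [h3]
      exact h2
  · obtain ⟨σ, hσ, hσ1, h⟩ := S.exists_runMid_al A hneA k (Nat.le_of_lt_succ hk) hA
    have h1 : (fun y x => trFst (runMid A S.protocol.bob x y k)) = fun _ x => σ x := by
      ext1 y
      ext1 x
      rw [h x y]
      have h2 : (bobZero ⊗ₖ proj (S.msg x y k)).trace = 1 := by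
        rw [Matrix.trace_kronecker, hproj, mul_one]
        exact trace_single_self _
      exact (trFst_kronecker _ _).trans ((congrArg (· • σ x) h2).trans (one_smul _ _))
    rw [h1]
    exact divulged_le_of_eq _ hμ' (one_le_card_reg q) hσ hσ1
  · cases k with
    | zero =>
      have h : ∀ x y, trFst (run S.protocol.al B x y 0) = Matrix.single 0 0 1 := by
        intro x y
        rw [run_zero, trFst_kronecker, Matrix.trace_kronecker, trace_single_self,
          trace_single_self, mul_one, one_smul]
      simp only [h]
      exact divulged_le_of_eq (τ := fun _ => Matrix.single 0 0 1) _ hμ (one_le_card_reg q)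
        (fun _ => posSemidef_single_self _) (fun _ => trace_single_self _)
    | succ k =>
      -- Honesty in the turn just completed is not needed here: any operation on `σ y ⊗ proj msg`
      -- obeys the bound. This also covers Bob's last turn, whose prescribed message need not be
      -- pure.
      obtain ⟨σ, hσ, hσ1, h⟩ := S.exists_runMid_bob B hneB k (Nat.le_of_succ_le_succ hk)
        fun x y j hj => hB x y j (by omega)
      have h3 : (fun x y => trFst (run S.protocol.al B x y (k + 1))) = fun x y =>
          trSnd ((B.op k y).app (σ y ⊗ₖ proj (S.msg x y k))) := by
        ext1 x
        ext1 y
        exact trFst_pass_act (B.op k y) (h x y) trace_one_reg_zero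
      rw [h3]
      exact divulged_trSnd_app_le f hμ (B.op k) hσ hσ1 (fun x y => posSemidef_proj _)
        (fun x y => hproj k x y)
  · obtain ⟨σ, hσ, hσ1, h⟩ := S.exists_runMid_bob B hneB k (Nat.le_of_lt_succ hk) hB
    have h1 : (fun x y => trSnd (runMid S.protocol.al B x y k)) =
        fun x y => σ y ⊗ₖ proj (S.msg x y k) := by
      ext1 x
      ext1 y
      rw [h x y]
      exact (trSnd_kronecker _ _).trans
        ((congrArg (· • (σ y ⊗ₖ proj (S.msg x y k))) trace_one_reg_zero).trans (one_smul _ _))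
    rw [h1]
    exact divulged_kronecker_le f hμ hσ hσ1 (fun x y => posSemidef_proj _)
      (fun x y => hproj k x y)

-- Bob's last operation permutes basis states, so measuring after it amounts to measuring the pure
-- message before it and relabelling the outcomes; the private qubit enters as `0`.
open Classical in
theorem outputProb_protocol (x : X) (y : Y) (z : Z) :
    S.protocol.outputProb x y z = ∑ s,
      if S.outAl (S.final y (0, s)).2 = z ∧ S.outBob (S.final y (0, s)).1 = z
      then Complex.normSq (S.msg x y S.turns s) else 0 := by
  set ψ : Reg 1 × Reg q → ℂ := fun w =>
    Pi.single (M := fun _ => ℂ) (0 : Reg 1) 1 w.1 * S.msg x y S.turns w.2 with hψ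
  have happ : (S.bobOp S.turns y).app (bobZero ⊗ₖ proj (S.msg x y S.turns)) =
      proj (S.finalMatrix y *ᵥ ψ) := by
    rw [bobOp, if_pos rfl, Channel.ofIsometry_app, bobZero, single_zero_eq_proj, ← proj_prod,
      mul_proj_mul]
  have hrun : ∀ (a : Reg 0) (m : Reg q) (b : Reg 1),
      run S.protocol.al S.protocol.bob x y (S.turns + 1) ((a, m), b) ((a, m), b) =
        (Complex.normSq (ψ ((S.final y).symm (b, m))) : ℂ) := by
    intro a m b
    have h1 : run S.protocol.al S.protocol.bob x y (S.turns + 1) =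
        pass ((S.bobOp S.turns y).act (runMid S.protocol.al S.protocol.bob x y S.turns)) := rfl
    have h2 : (S.bobOp S.turns y).act (runMid S.protocol.al S.protocol.bob x y S.turns) =
        proj (S.finalMatrix y *ᵥ ψ) ⊗ₖ (1 : Matrix (Reg 0) (Reg 0) ℂ) := by
      rw [S.runMid_honest x y le_rfl, ← happ]
      exact Channel.act_kronecker _ _ _
    rw [h1, h2]
    change (proj (S.finalMatrix y *ᵥ ψ) (b, m) (b, m)) * (1 : Matrix (Reg 0) (Reg 0) ℂ) a a = _
    rw [Matrix.one_apply_eq, mul_one, proj_apply, finalMatrix_mulVec, Complex.star_def,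
      Complex.mul_conj]
  have e1 : S.protocol.outputProb x y z = ∑ a : Reg 0, ∑ m : Reg q, ∑ b : Reg 1,
      if S.outAl m = z ∧ S.outBob b = z then
        Complex.normSq (ψ ((S.final y).symm (b, m))) else 0 := by
    rw [Protocol.outputProb]
    refine (Fintype.sum_prod_type _).trans ((Fintype.sum_prod_type _).trans ?_)
    refine Finset.sum_congr rfl fun a _ => Finset.sum_congr rfl fun m _ =>
      Finset.sum_congr rfl fun b _ => ?_
    refine if_congr Iff.rfl ?_ rfl
    exact (congrArg Complex.re (hrun a m b)).trans (Complex.ofReal_re _)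
  rw [e1, Fintype.sum_unique, Finset.sum_comm, ← Fintype.sum_prod_type'
    (fun (b : Reg 1) (m : Reg q) => if S.outAl m = z ∧ S.outBob b = z then
        Complex.normSq (ψ ((S.final y).symm (b, m))) else 0), ← Equiv.sum_comp (S.final y)]
  simp only [Prod.mk.eta, Equiv.symm_apply_apply]
  rw [Fintype.sum_prod_type, Finset.sum_eq_single 0]
  · simp [hψ]
  · intro b _ hb
    simp [hψ, hb]
  · simp

end PingPong

/-! ### The distributed Grover iteration. -/

namespace Grover

variable {M N : ℕ}

/-- Basis states of one run of the search: an index, a flag, and the number of iterations. -/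
abbrev Cell (M N : ℕ) : Type := (Fin N × Bool) × Fin M

/-- Add `x i` to the flag. -/
def flagPerm (x : Fin N → Bool) : Equiv.Perm (Fin N × Bool) :=
  Function.Involutive.toPerm (fun s => (s.1, xor s.2 (x s.1))) fun s => by
    ext <;> simp

lemma flagPerm_apply (x : Fin N → Bool) (s : Fin N × Bool) :
    flagPerm x s = (s.1, xor s.2 (x s.1)) := rfl

/-- The inversion about the mean. -/
def diffusion (N : ℕ) : Matrix (Fin N) (Fin N) ℂ :=
  Matrix.of fun i i' => 2 / (N : ℂ) - if i = i' then 1 else 0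

lemma diffusion_isometry [NeZero N] : (diffusion N)ᴴ * diffusion N = 1 := by
  have hN : (N : ℂ) ≠ 0 := by exact_mod_cast NeZero.ne N
  ext i j
  rw [Matrix.mul_apply]
  have : ∀ k, (diffusion N)ᴴ i k * diffusion N k j =
      4 / (N : ℂ) ^ 2 - (if k = j then 2 / (N : ℂ) else 0) - (if k = i then 2 / (N : ℂ) else 0) +
        if k = i then (if i = j then 1 else 0) else 0 := by
    intro k
    simp only [diffusion, Matrix.conjTranspose_apply, Matrix.of_apply, star_sub, star_div₀]
    rw [show star (2 : ℂ) = 2 from Complex.conj_ofNat 2, show star (N : ℂ) = N from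
      Complex.conj_natCast N]
    by_cases h1 : k = i
    · subst h1
      by_cases h2 : k = j
      · simp only [h2, if_true, star_one]; field_simp; ring
      · simp only [h2, if_true, if_false, star_one]; field_simp; ring
    · by_cases h2 : k = j
      · simp only [if_neg h1, if_pos h2, star_zero]; field_simp; ring
      · simp only [if_neg h1, if_neg h2, star_zero]; field_simp; ring
  simp only [this, Finset.sum_add_distrib, Finset.sum_sub_distrib, Finset.sum_ite_eq',
    Finset.mem_univ, if_true, Finset.sum_const, Finset.card_univ, Fintype.card_fin,
    Matrix.one_apply, nsmul_eq_mul]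
  field_simp
  ring

/-- The diffusion step of Al, who removes and restores the flag. -/
def alStep (x : Fin N → Bool) : Matrix (Fin N × Bool) (Fin N × Bool) ℂ :=
  (diffusion N ⊗ₖ (1 : Matrix Bool Bool ℂ)).submatrix (flagPerm x) (flagPerm x)

lemma alStep_isometry [NeZero N] (x : Fin N → Bool) : (alStep x)ᴴ * alStep x = 1 := by
  rw [alStep, Matrix.conjTranspose_submatrix, Matrix.submatrix_mul_equiv,
    Matrix.conjTranspose_kronecker, ← Matrix.mul_kronecker_mul, diffusion_isometry]
  simp

/-- Al's operation after `k` iterations. -/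
def alMatrix (M : ℕ) (k : ℕ) (x : Fin N → Bool) : Matrix (Cell M N) (Cell M N) ℂ :=
  Matrix.blockDiagonal fun j : Fin M => if k < j then alStep x else 1

lemma alMatrix_isometry [NeZero N] (k : ℕ) (x : Fin N → Bool) :
    (alMatrix M k x)ᴴ * alMatrix M k x = 1 := by
  rw [alMatrix, Matrix.blockDiagonal_conjTranspose, ← Matrix.blockDiagonal_mul]
  have : (fun j : Fin M => (if k < j then alStep x else 1)ᴴ * if k < j then alStep x else 1) =
      1 := by
    ext1 j
    rw [Pi.one_apply]
    split_ifs
    · exact alStep_isometry x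
    · simp
  rw [this, Matrix.blockDiagonal_one]

/-- The flag tells that `i` belongs to both sets. -/
def good (y : Fin N → Bool) (s : Cell M N) : Bool := s.1.2 && y s.1.1

/-- Bob's operation: a phase for the common elements. -/
def bobMatrix (M : ℕ) (ω : ℂ) (y : Fin N → Bool) : Matrix (Cell M N) (Cell M N) ℂ :=
  Matrix.diagonal fun s => if good y s then ω else 1

lemma bobMatrix_isometry {ω : ℂ} (hω : star ω * ω = 1) (y : Fin N → Bool) :
    (bobMatrix M ω y)ᴴ * bobMatrix M ω y = 1 := by
  rw [bobMatrix, Matrix.diagonal_conjTranspose, Matrix.diagonal_mul_diagonal,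
    ← Matrix.diagonal_one]
  congr 1
  ext s
  simp only [Pi.star_apply]
  split_ifs
  · exact hω
  · simp

/-- The initial amplitude. -/
def amp (M N : ℕ) : ℝ := (Real.sqrt (M * N))⁻¹

lemma amp_sq [NeZero M] [NeZero N] : amp M N ^ 2 = 1 / ((M : ℝ) * N) := by
  rw [amp, inv_pow, Real.sq_sqrt (by positivity), one_div]

/-- The first message. -/
def initVec (M : ℕ) (x : Fin N → Bool) : Cell M N → ℂ :=
  fun s => if s.1.2 = x s.1.1 then (amp M N : ℂ) else 0

/-- The state of one run after `k` iterations. -/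
def vec (M : ℕ) (ω : ℂ) (x y : Fin N → Bool) : ℕ → Cell M N → ℂ
  | 0 => initVec M x
  | k + 1 => alMatrix M k x *ᵥ (bobMatrix M ω y *ᵥ vec M ω x y k)

/-- The phase of an index. -/
def phase (ω : ℂ) (x y : Fin N → Bool) (i : Fin N) : ℂ := if x i && y i then ω else 1

/-- The amplitudes of `vec`, without the flag. -/
def coef (M : ℕ) (ω : ℂ) (x y : Fin N → Bool) : ℕ → ℕ → Fin N → ℂ
  | 0, _, _ => (amp M N : ℂ)
  | k + 1, j, i =>
    if k < j then
      2 / (N : ℂ) * ∑ i', phase ω x y i' * coef M ω x y k j i' - phase ω x y i * coef M ω x y k j i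
    else phase ω x y i * coef M ω x y k j i

lemma blockDiagonal_mulVec {m o : Type} [Fintype m] [Fintype o] [DecidableEq o]
    (B : o → Matrix m m ℂ) (v : m × o → ℂ) (s : m × o) :
    (Matrix.blockDiagonal B *ᵥ v) s = (B s.2 *ᵥ fun i => v (i, s.2)) s.1 := by
  simp only [Matrix.mulVec, dotProduct, Fintype.sum_prod_type, Matrix.blockDiagonal_apply]
  refine Finset.sum_congr rfl fun i _ => ?_
  rw [Finset.sum_eq_single s.2 (fun b _ hb => by simp [hb.symm]) (by simp)]
  simp

/-- On vectors supported on flag `= x i`, removing the flag leaves it blank, so the diffusion acts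
on the indices alone, and the flag is then restored. -/
lemma alStep_mulVec (x : Fin N → Bool) (w : Fin N → ℂ) (s : Fin N × Bool) :
    (alStep x *ᵥ fun s => if s.2 = x s.1 then w s.1 else 0) s =
      if s.2 = x s.1 then 2 / (N : ℂ) * ∑ i, w i - w s.1 else 0 := by
  rw [Matrix.mulVec, dotProduct, Fintype.sum_prod_type]
  have : ∀ i, ∑ a, alStep x s (i, a) * (if a = x i then w i else 0) =
      if s.2 = x s.1 then 2 / (N : ℂ) * w i - (if s.1 = i then w i else 0) else 0 := by
    intro i
    rw [Finset.sum_eq_single (x i) (fun b _ hb => by simp [hb]) (by simp), if_pos rfl]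
    simp only [alStep, Matrix.submatrix_apply, flagPerm_apply,
      Matrix.kroneckerMap_apply, diffusion, Matrix.of_apply, Matrix.one_apply, Bool.xor_self]
    by_cases h : s.2 = x s.1
    · by_cases h2 : s.1 = i
      · simp [h, h2]; ring
      · simp [h, h2]
    · have : ¬ (s.2 ^^ x s.1) = false := by simpa using h
      simp [h, this]
  simp only [this]
  split_ifs
  · rw [Finset.sum_sub_distrib, ← Finset.mul_sum, Finset.sum_ite_eq]
    simp
  · simp

lemma vec_eq (ω : ℂ) (x y : Fin N → Bool) (k : ℕ) (s : Cell M N) :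
    vec M ω x y k s = if s.1.2 = x s.1.1 then coef M ω x y k s.2 s.1.1 else 0 := by
  induction k generalizing s with
  | zero => rfl
  | succ k ih =>
    rw [vec, alMatrix, blockDiagonal_mulVec]
    have h : (fun i : Fin N × Bool => (bobMatrix M ω y *ᵥ vec M ω x y k) (i, s.2)) =
        fun i => if i.2 = x i.1 then phase ω x y i.1 * coef M ω x y k s.2 i.1 else 0 := by
      ext i
      rw [bobMatrix, Matrix.mulVec_diagonal, ih]
      by_cases h : i.2 = x i.1
      · simp [h, good, phase]
      · simp [h]
    rw [h]
    by_cases hk : k < (s.2 : ℕ)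
    · rw [if_pos hk, alStep_mulVec x (fun i => phase ω x y i * coef M ω x y k s.2 i)]
      simp only [coef, if_pos hk]
    · rw [if_neg hk, Matrix.one_mulVec]
      simp only [coef, if_neg hk]

lemma initVec_unit [NeZero M] [NeZero N] (x : Fin N → Bool) :
    star (initVec M x) ⬝ᵥ initVec M x = 1 := by
  have hM : (M : ℂ) ≠ 0 := by exact_mod_cast NeZero.ne M
  have hN : (N : ℂ) ≠ 0 := by exact_mod_cast NeZero.ne N
  have h : ((amp M N : ℝ) : ℂ) * amp M N = ((1 / ((M : ℝ) * N) : ℝ) : ℂ) := by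
    rw [← amp_sq]
    push_cast
    ring
  simp only [dotProduct, initVec, Fintype.sum_prod_type, Pi.star_apply, apply_ite star, star_zero]
  rw [show star (amp M N : ℂ) = amp M N from Complex.conj_ofReal _]
  simp only [ite_mul, mul_ite, h, zero_mul, mul_zero, Finset.sum_const, Finset.card_univ,
    Fintype.card_fin]
  simp
  field_simp

lemma vec_unit [NeZero M] [NeZero N] {ω : ℂ} (hω : star ω * ω = 1) (x y : Fin N → Bool) (k : ℕ) :
    star (vec M ω x y k) ⬝ᵥ vec M ω x y k = 1 := by
  induction k with
  | zero => exact initVec_unit x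
  | succ k ih =>
    rw [vec, star_mulVec_dotProduct_mulVec (alMatrix_isometry k x),
      star_mulVec_dotProduct_mulVec (bobMatrix_isometry hω y), ih]

/-- The inversion about the mean fixes the uniform vector. So at `ω = 1` the messages never change
and do not depend on `y`; this is the base point of the analyticity argument. -/
lemma coef_one [NeZero N] (x y : Fin N → Bool) (k j : ℕ) (i : Fin N) :
    coef M 1 x y k j i = amp M N := by
  have hN : (N : ℂ) ≠ 0 := by exact_mod_cast NeZero.ne N
  induction k generalizing i with
  | zero => rfl
  | succ k ih =>
    simp only [coef, ih, phase, ite_self, one_mul, Finset.sum_const, Finset.card_univ,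
      Fintype.card_fin, nsmul_eq_mul]
    split_ifs
    · field_simp
      ring
    · rfl

lemma bobMatrix_one (y : Fin N → Bool) : bobMatrix M 1 y = 1 := by
  simp [bobMatrix]

/-- All terms of the inner product are nonnegative, and those at the index `i₀`, where the flags
agree, are positive. -/
lemma star_vec_one_dotProduct_ne_zero [NeZero M] [NeZero N] (x x' y : Fin N → Bool) (k : ℕ)
    {i₀ : Fin N} (h : x i₀ = x' i₀) :
    star (vec M 1 x y k) ⬝ᵥ vec M 1 x' y k ≠ 0 := by
  have e : ∀ s, star (vec M 1 x y k s) * vec M 1 x' y k s =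
      ((if s.1.2 = x s.1.1 ∧ s.1.2 = x' s.1.1 then amp M N ^ 2 else 0 : ℝ) : ℂ) := by
    intro s
    rw [vec_eq, vec_eq, coef_one, coef_one]
    by_cases h1 : s.1.2 = x s.1.1 <;> by_cases h2 : s.1.2 = x' s.1.1 <;> simp [h1, h2, sq]
    all_goals simp_all
  simp only [dotProduct, Pi.star_apply, e]
  rw [← Complex.ofReal_sum]
  refine Complex.ofReal_ne_zero.2 (ne_of_gt ?_)
  refine Finset.sum_pos' (fun s _ => ?_) ⟨((i₀, x i₀), 0), Finset.mem_univ _, ?_⟩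
  · split_ifs
    · positivity
    · exact le_rfl
  · rw [if_pos ⟨rfl, h⟩, amp_sq]
    have hM : (0 : ℝ) < M := by exact_mod_cast NeZero.pos M
    have hN : (0 : ℝ) < N := by exact_mod_cast NeZero.pos N
    positivity

lemma vec_one_eq [NeZero N] (x y y' : Fin N → Bool) (k : ℕ) :
    vec M 1 x y k = vec M 1 x y' k := by
  ext s
  rw [vec_eq, vec_eq, coef_one, coef_one]


/-! ### The success probability for the phase `-1`. -/

variable {M N : ℕ}

/-- The probability that measuring one run yields a common element. -/
def success (M : ℕ) (ω : ℂ) (x y : Fin N → Bool) (k : ℕ) : ℝ :=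
  ∑ s : Cell M N, if good y s then Complex.normSq (vec M ω x y k s) else 0

/-- Branch `j` is finished after `j` iterations: from then on Al leaves it alone, and Bob's phases
do not change the moduli. -/
lemma normSq_coef_of_le {ω : ℂ} (hω : Complex.normSq ω = 1) (x y : Fin N → Bool) {j k : ℕ}
    (h : j ≤ k) (i : Fin N) :
    Complex.normSq (coef M ω x y k j i) = Complex.normSq (coef M ω x y j j i) := by
  induction k, h using Nat.le_induction with
  | base => rfl
  | succ k hk ih =>
    rw [coef, if_neg (by omega), Complex.normSq_mul, ih, phase]
    split_ifs <;> simp [hω]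

/-- The number of common elements. -/
def common (x y : Fin N → Bool) : ℕ := (Finset.univ.filter fun i => (x i && y i) = true).card

lemma success_eq {ω : ℂ} (hω : Complex.normSq ω = 1) (x y : Fin N → Bool) {k : ℕ}
    (hk : M ≤ k + 1) :
    success M ω x y k = ∑ j : Fin M, ∑ i, if x i && y i then
      Complex.normSq (coef M ω x y j j i) else 0 := by
  rw [success, Fintype.sum_prod_type_right]
  refine Finset.sum_congr rfl fun j _ => ?_
  rw [Fintype.sum_prod_type]
  refine Finset.sum_congr rfl fun i _ => ?_
  rw [Finset.sum_eq_single (x i)]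
  · rw [vec_eq, if_pos rfl, normSq_coef_of_le hω x y (by omega)]
    rfl
  · intro b _ hb
    rw [vec_eq, if_neg hb]
    simp
  · simp

/-- Grover's rotation: with `sin² φ` the fraction of common elements, each iteration turns the state
by `2φ` in the plane spanned by the common and the other indices, starting at angle `φ`. -/
lemma coef_neg_one [NeZero N] (x y : Fin N → Bool) {φ : ℝ} (hs : Real.sin φ ≠ 0)
    (hc : Real.cos φ ≠ 0) (ht : (common x y : ℝ) = N * Real.sin φ ^ 2) {k j : ℕ} (hk : k ≤ j)
    (i : Fin N) :
    coef M (-1) x y k j i =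
      ((amp M N * if x i && y i then Real.sin ((2 * k + 1) * φ) / Real.sin φ
        else Real.cos ((2 * k + 1) * φ) / Real.cos φ : ℝ) : ℂ) := by
  have hN : (N : ℝ) ≠ 0 := by exact_mod_cast NeZero.ne N
  induction k generalizing i with
  | zero => split_ifs <;> simp [coef, hs, hc]
  | succ k ih =>
    have ih := ih (by omega)
    rw [coef, if_pos (by omega)]
    simp only [ih]
    set s := Real.sin ((2 * k + 1) * φ) with hsk
    set c := Real.cos ((2 * k + 1) * φ) with hck
    have hph : ∀ i, phase (-1) x y i = ((if x i && y i then -1 else 1 : ℝ) : ℂ) := by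
      intro i
      unfold phase
      split_ifs <;> simp
    have hcast : (2 : ℂ) / (N : ℂ) = ((2 / N : ℝ) : ℂ) := by push_cast; rfl
    simp only [hph, hcast, ← Complex.ofReal_mul, ← Complex.ofReal_sum, ← Complex.ofReal_sub]
    refine congrArg Complex.ofReal ?_
    push_cast
    have hsum : ∑ i, (if x i && y i then (-1 : ℝ) else 1) *
        (amp M N * if x i && y i then s / Real.sin φ else c / Real.cos φ) =
        amp M N * (N * (Real.cos φ * c - Real.sin φ * s)) := by
      have e : ∀ i, (if x i && y i then (-1 : ℝ) else 1) *
          (amp M N * if x i && y i then s / Real.sin φ else c / Real.cos φ) =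
          amp M N * (c / Real.cos φ) + if x i && y i then
            -(amp M N * (s / Real.sin φ)) - amp M N * (c / Real.cos φ) else 0 := by
        intro i
        split_ifs <;> ring
      simp only [e]
      rw [Finset.sum_add_distrib, ← Finset.sum_filter, Finset.sum_const, Finset.sum_const,
        nsmul_eq_mul, nsmul_eq_mul]
      change _ + (common x y : ℝ) * _ = _
      rw [ht, Finset.card_univ, Fintype.card_fin]
      have h1 := Real.sin_sq_add_cos_sq φ
      have h2 : (1 - Real.sin φ ^ 2) = Real.cos φ ^ 2 := by linarith
      have h3 : (N : ℝ) * (amp M N * (c / Real.cos φ)) + N * Real.sin φ ^ 2 *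
          (-(amp M N * (s / Real.sin φ)) - amp M N * (c / Real.cos φ)) =
          amp M N * (N * ((1 - Real.sin φ ^ 2) * (c / Real.cos φ) -
            Real.sin φ ^ 2 * (s / Real.sin φ))) := by ring
      rw [h3, h2]
      field_simp
    rw [hsum]
    have hang : (2 * ((k : ℝ) + 1) + 1) * φ = (2 * k + 1) * φ + 2 * φ := by ring
    rw [hang, Real.sin_add, Real.cos_add, ← hsk, ← hck, Real.sin_two_mul, Real.cos_two_mul]
    have h1 := Real.sin_sq_add_cos_sq φ
    split_ifs
    · have h4 : Real.cos φ ^ 2 = 1 - Real.sin φ ^ 2 := by linarith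
      rw [h4]
      field_simp
      ring
    · have h4 : Real.sin φ ^ 2 = 1 - Real.cos φ ^ 2 := by linarith
      field_simp
      ring_nf

lemma sum_cos_mul_sin (α : ℝ) (m : ℕ) :
    (∑ j ∈ Finset.range m, Real.cos ((2 * j + 1) * α)) * (2 * Real.sin α) =
      Real.sin (2 * m * α) := by
  induction m with
  | zero => simp
  | succ m ih =>
    rw [Finset.sum_range_succ, add_mul, ih]
    have e1 : 2 * (m : ℝ) * α = (2 * m + 1) * α - α := by ring
    have e2 : 2 * ((m + 1 : ℕ) : ℝ) * α = (2 * m + 1) * α + α := by push_cast; ring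
    rw [e1, e2, Real.sin_sub, Real.sin_add]
    ring

/-- The average of `sin²((2j + 1)φ)` over `j < M` is `1/2` minus a cosine sum that telescopes after
multiplication by `2 sin 2φ`. It is small once `M sin 2φ` is bounded below. -/
lemma le_success_neg_one [NeZero M] [NeZero N] (hMN : M ^ 2 = 16 * N) (x y : Fin N → Bool)
    (h0 : 0 < common x y) (h2 : 2 * common x y ≤ N) {k : ℕ} (hk : M ≤ k + 1) :
    7 / 16 ≤ success M (-1) x y k := by
  have hN : (0 : ℝ) < N := by exact_mod_cast NeZero.pos N
  have hM : (0 : ℝ) < M := by exact_mod_cast NeZero.pos M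
  set t : ℝ := ((common x y : ℕ) : ℝ) with ht
  have ht1 : 1 ≤ t := by rw [ht]; exact_mod_cast h0
  have ht2 : 2 * t ≤ N := by rw [ht]; exact_mod_cast h2
  set u := Real.sqrt (t / N) with hu
  have hu0 : 0 < u := Real.sqrt_pos.2 (by positivity)
  have husq : u ^ 2 = t / N := Real.sq_sqrt (by positivity)
  have hu1 : u ^ 2 ≤ 1 / 2 := by
    rw [husq, div_le_iff₀ hN]
    linarith
  have hu2 : u ≤ 1 := by nlinarith
  set φ := Real.arcsin u with hφ
  have hsin : Real.sin φ = u := Real.sin_arcsin (by linarith) hu2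
  have hcos0 : 0 ≤ Real.cos φ := Real.cos_arcsin_nonneg u
  have hcsq : Real.cos φ ^ 2 = 1 - u ^ 2 := by
    have := Real.sin_sq_add_cos_sq φ
    rw [hsin] at this
    linarith
  have hcos : 0 < Real.cos φ := by
    rcases hcos0.eq_or_lt with h | h
    · rw [← h] at hcsq
      linarith
    · exact h
  have hsin2 : 0 < Real.sin (2 * φ) := by
    rw [Real.sin_two_mul, hsin]
    positivity
  have htN : t = N * Real.sin φ ^ 2 := by
    rw [hsin, husq]
    field_simp
  rw [success_eq (by simp) x y hk]
  have hterm : ∀ j : Fin M, (∑ i, if x i && y i then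
      Complex.normSq (coef M (-1) x y j j i) else 0) =
      (1 / (M : ℝ)) * (1 / 2 - Real.cos ((2 * (j : ℕ) + 1) * (2 * φ)) / 2) := by
    intro j
    have e : ∀ i, (if x i && y i then Complex.normSq (coef M (-1) x y j j i) else 0) =
        if x i && y i then amp M N ^ 2 * (Real.sin ((2 * (j : ℕ) + 1) * φ) / Real.sin φ) ^ 2
        else 0 := by
      intro i
      split_ifs with h
      · rw [coef_neg_one x y (hsin ▸ hu0.ne') hcos.ne' htN le_rfl i, if_pos h,
          Complex.normSq_ofReal]
        ring
      · rfl
    simp only [e]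
    rw [← Finset.sum_filter, Finset.sum_const, nsmul_eq_mul]
    change t * _ = _
    rw [htN, amp_sq, show (2 * ((j : ℕ) : ℝ) + 1) * (2 * φ) = 2 * ((2 * (j : ℕ) + 1) * φ) by ring,
      Real.cos_two_mul, div_pow, Real.sin_sq ((2 * ((j : ℕ) : ℝ) + 1) * φ)]
    have : Real.sin φ ≠ 0 := hsin ▸ hu0.ne'
    field_simp
    ring
  simp only [hterm]
  rw [← Finset.mul_sum, Finset.sum_sub_distrib, Finset.sum_const,
    Finset.card_univ, Fintype.card_fin, nsmul_eq_mul,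
    ← Finset.sum_div Finset.univ (fun j : Fin M => Real.cos ((2 * ((j : ℕ) : ℝ) + 1) * (2 * φ))),
    Fin.sum_univ_eq_sum_range (fun j => Real.cos ((2 * (j : ℝ) + 1) * (2 * φ))) M]
  have hS := sum_cos_mul_sin (2 * φ) M
  set C := ∑ j ∈ Finset.range M, Real.cos ((2 * (j : ℝ) + 1) * (2 * φ)) with hC
  have hle : C * (2 * Real.sin (2 * φ)) ≤ 1 := hS ▸ Real.sin_le_one _
  -- The square is `16 N * 4 u² (1 - u²) = 64 t (1 - u²) ≥ 32`, since `t ≥ 1` and `u² ≤ 1/2`. The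
  -- last bound is why at most half of the indices may be common.
  have hMsin : 4 ≤ M * Real.sin (2 * φ) := by
    have h1 : (M : ℝ) ^ 2 = 16 * N := by exact_mod_cast hMN
    have h3 : (16 : ℝ) ≤ (M * Real.sin (2 * φ)) ^ 2 := by
      rw [mul_pow, h1, Real.sin_two_mul, hsin, mul_pow, mul_pow, hcsq]
      have h4 : (N : ℝ) * u ^ 2 = t := by rw [husq]; field_simp
      nlinarith
    nlinarith [mul_pos hM hsin2]
  have hC8 : C ≤ M / 8 := by
    by_contra hcon
    push Not at hcon
    nlinarith
  have : (1 / (M : ℝ)) * (M * (1 / 2) - C / 2) = 1 / 2 - C / (2 * M) := by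
    field_simp
  rw [this]
  have h5 : C / (2 * M) ≤ 1 / 16 := by
    rw [div_le_iff₀ (by positivity)]
    linarith
  linarith

/-! ### A phase that avoids orthogonal messages. -/

/-- The phase `e^{iθ}`. -/
def rot (θ : ℝ) : ℂ := Complex.exp (θ * Complex.I)

lemma star_rot_mul (θ : ℝ) : star (rot θ) * rot θ = 1 := by
  rw [Complex.star_def, ← Complex.normSq_eq_conj_mul_self, Complex.normSq_eq_norm_sq, rot,
    Complex.norm_exp_ofReal_mul_I]
  simp

lemma analyticAt_rot (θ : ℝ) : AnalyticAt ℝ rot θ := by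
  have h1 : AnalyticAt ℝ (fun θ : ℝ => (θ : ℂ) * Complex.I) θ :=
    (Complex.ofRealCLM.analyticAt θ).mul analyticAt_const
  exact (analyticAt_cexp.restrictScalars (𝕜 := ℝ)).fun_comp h1

lemma analyticAt_vec (x y : Fin N → Bool) (k : ℕ) (s : Cell M N) (θ : ℝ) :
    AnalyticAt ℝ (fun θ => vec M (rot θ) x y k s) θ := by
  induction k generalizing s with
  | zero => exact analyticAt_const
  | succ k ih =>
    simp only [vec, Matrix.mulVec, dotProduct]
    refine Finset.analyticAt_fun_sum _ fun t _ => analyticAt_const.mul ?_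
    simp only [bobMatrix, Matrix.diagonal_apply]
    refine Finset.analyticAt_fun_sum _ fun r _ => AnalyticAt.mul ?_ (ih r)
    split_ifs
    · exact analyticAt_rot θ
    · exact analyticAt_const
    · exact analyticAt_const

lemma analyticAt_star {f : ℝ → ℂ} {θ : ℝ} (hf : AnalyticAt ℝ f θ) :
    AnalyticAt ℝ (fun θ => star (f θ)) θ :=
  (Complex.conjCLE.toContinuousLinearMap.analyticAt (f θ)).fun_comp hf

lemma analyticAt_bobMatrix_mulVec (x y : Fin N → Bool) (k : ℕ) (s : Cell M N) (θ : ℝ) :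
    AnalyticAt ℝ (fun θ => (bobMatrix M (rot θ) y *ᵥ vec M (rot θ) x y k) s) θ := by
  simp only [bobMatrix, Matrix.mulVec_diagonal]
  refine AnalyticAt.mul ?_ (analyticAt_vec x y k s θ)
  split_ifs
  · exact analyticAt_rot θ
  · exact analyticAt_const

/-- By the identity theorem on the connected line, zeros that accumulate at `θ` would force `f 0 =
0`. Analyticity is over `ℝ`, because the inner products involve complex conjugation. -/
lemma eventually_ne_of_analytic {f : ℝ → ℂ} (hf : ∀ θ, AnalyticAt ℝ f θ) (h0 : f 0 ≠ 0) (θ : ℝ) :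
    ∀ᶠ z in nhdsWithin θ {θ}ᶜ, f z ≠ 0 := by
  rcases (hf θ).eventually_eq_zero_or_eventually_ne_zero with h | h
  · exfalso
    have := AnalyticOnNhd.eqOn_zero_of_preconnected_of_eventuallyEq_zero
      (U := Set.univ) (fun z _ => hf z) isPreconnected_univ (Set.mem_univ θ) h
    exact h0 (this (Set.mem_univ 0))
  · exact h

lemma continuous_success (x y : Fin N → Bool) (k : ℕ) :
    Continuous fun θ => success M (rot θ) x y k := by
  unfold success
  refine continuous_finsetSum _ fun s _ => ?_
  split_ifs
  · exact Complex.continuous_normSq.comp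
      (continuous_iff_continuousAt.2 fun θ => (analyticAt_vec x y k s θ).continuousAt)
  · exact continuous_const

/-- There is a phase for which the search still succeeds, while no two states that a player can
receive are orthogonal. -/
lemma exists_phase [NeZero M] [NeZero N] (hMN : M ^ 2 = 16 * N) {ι : Type} [Finite ι]
    (v : ι → Fin N → Bool) {i₀ : Fin N} (hv : ∀ a, v a i₀ = false)
    (hcommon : ∀ a b, 2 * common (v a) (v b) ≤ N) {T : ℕ} (hT : M ≤ T + 1) :
    ∃ ω : ℂ, star ω * ω = 1 ∧
      (∀ k < T, ∀ a a' b, star (vec M ω (v a) (v b) k) ⬝ᵥ vec M ω (v a') (v b) k ≠ 0) ∧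
      (∀ k < T, ∀ a b b', star (bobMatrix M ω (v b) *ᵥ vec M ω (v a) (v b) k) ⬝ᵥ
        (bobMatrix M ω (v b') *ᵥ vec M ω (v a) (v b') k) ≠ 0) ∧
      ∀ a b, 0 < common (v a) (v b) → 3 / 7 < success M ω (v a) (v b) T := by
  have hrot0 : rot 0 = 1 := by simp [rot]
  have hrotpi : rot Real.pi = -1 := Complex.exp_pi_mul_I
  have h1 : ∀ᶠ θ in nhdsWithin Real.pi {Real.pi}ᶜ, ∀ k : Fin T, ∀ a a' b,
      star (vec M (rot θ) (v a) (v b) k) ⬝ᵥ vec M (rot θ) (v a') (v b) k ≠ 0 := by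
    simp only [Filter.eventually_all]
    intro k a a' b
    refine eventually_ne_of_analytic (f := fun θ =>
      star (vec M (rot θ) (v a) (v b) k) ⬝ᵥ vec M (rot θ) (v a') (v b) k) (fun θ => ?_) ?_ _
    · simp only [dotProduct, Pi.star_apply]
      exact Finset.analyticAt_fun_sum _ fun s _ =>
        (analyticAt_star (analyticAt_vec _ _ _ _ θ)).mul (analyticAt_vec _ _ _ _ θ)
    · simp only [hrot0]
      exact star_vec_one_dotProduct_ne_zero _ _ _ _ ((hv a).trans (hv a').symm)
  have h2 : ∀ᶠ θ in nhdsWithin Real.pi {Real.pi}ᶜ, ∀ k : Fin T, ∀ a b b',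
      star (bobMatrix M (rot θ) (v b) *ᵥ vec M (rot θ) (v a) (v b) k) ⬝ᵥ
        (bobMatrix M (rot θ) (v b') *ᵥ vec M (rot θ) (v a) (v b') k) ≠ 0 := by
    simp only [Filter.eventually_all]
    intro k a b b'
    refine eventually_ne_of_analytic (f := fun θ =>
      star (bobMatrix M (rot θ) (v b) *ᵥ vec M (rot θ) (v a) (v b) k) ⬝ᵥ
        (bobMatrix M (rot θ) (v b') *ᵥ vec M (rot θ) (v a) (v b') k)) (fun θ => ?_) ?_ _
    · simp only [dotProduct, Pi.star_apply]
      exact Finset.analyticAt_fun_sum _ fun s _ =>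
        (analyticAt_star (analyticAt_bobMatrix_mulVec _ _ _ _ θ)).mul
          (analyticAt_bobMatrix_mulVec _ _ _ _ θ)
    · simp only [hrot0, bobMatrix_one, Matrix.one_mulVec]
      rw [vec_one_eq (v a) (v b') (v b), vec_unit (by simp)]
      exact one_ne_zero
  have h3 : ∀ᶠ θ in nhdsWithin Real.pi {Real.pi}ᶜ, ∀ a b, 0 < common (v a) (v b) →
      3 / 7 < success M (rot θ) (v a) (v b) T := by
    simp only [Filter.eventually_all]
    intro a b hab
    refine nhdsWithin_le_nhds ?_
    refine (continuous_success (v a) (v b) T).continuousAt.eventually_const_lt ?_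
    simp only [hrotpi]
    -- `3/7 < 7/16`: strictness leaves room to move away from `θ = π`.
    exact lt_of_lt_of_le (by norm_num) (le_success_neg_one hMN _ _ hab (hcommon a b) hT)
  -- Finitely many conditions hold on a punctured neighbourhood of `π`, which is nonempty.
  obtain ⟨θ, ⟨h1, h2⟩, h3⟩ := ((h1.and h2).and h3).exists
  exact ⟨rot θ, star_rot_mul θ, fun k hk => h1 ⟨k, hk⟩, fun k hk => h2 ⟨k, hk⟩, h3⟩


lemma kronecker_mulVec_prod {A B : Type} [Fintype A] [Fintype B] (U : Matrix A A ℂ)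
    (V : Matrix B B ℂ) (u : A → ℂ) (v : B → ℂ) :
    (U ⊗ₖ V) *ᵥ (fun z => u z.1 * v z.2) = fun z => (U *ᵥ u) z.1 * (V *ᵥ v) z.2 := by
  ext z
  simp only [Matrix.mulVec, dotProduct, Matrix.kroneckerMap_apply, Fintype.sum_prod_type,
    Finset.sum_mul_sum]
  refine Finset.sum_congr rfl fun i _ => Finset.sum_congr rfl fun j _ => ?_
  ring

/-! ### Two parallel copies. -/

section Double

variable {K : Type} [Fintype K] [DecidableEq K]

/-- The state of a blank result bit. -/
def blank : Bool → ℂ := fun r => if r then 0 else 1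

lemma star_blank_dotProduct : star blank ⬝ᵥ blank = 1 := by
  simp [blank, dotProduct]

/-- Two copies of a state, and a blank result bit. -/
def doubleVec (ψ : K → ℂ) : (K × K) × Bool → ℂ :=
  fun z => (fun w : K × K => ψ w.1 * ψ w.2) z.1 * blank z.2

/-- The same operation on both copies. -/
def doubleMatrix (U : Matrix K K ℂ) : Matrix ((K × K) × Bool) ((K × K) × Bool) ℂ :=
  (U ⊗ₖ U) ⊗ₖ (1 : Matrix Bool Bool ℂ)

lemma doubleMatrix_mulVec (U : Matrix K K ℂ) (ψ : K → ℂ) :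
    doubleMatrix U *ᵥ doubleVec ψ = doubleVec (U *ᵥ ψ) := by
  refine (kronecker_mulVec_prod (U ⊗ₖ U) 1 (fun w : K × K => ψ w.1 * ψ w.2) blank).trans ?_
  rw [kronecker_mulVec_prod, Matrix.one_mulVec]
  rfl

lemma doubleMatrix_isometry {U : Matrix K K ℂ} (h : Uᴴ * U = 1) :
    (doubleMatrix U)ᴴ * doubleMatrix U = 1 := by
  rw [doubleMatrix, Matrix.conjTranspose_kronecker, Matrix.conjTranspose_kronecker,
    ← Matrix.mul_kronecker_mul, ← Matrix.mul_kronecker_mul, h]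
  simp

/-- Inner products are merely squared, so nonorthogonality passes from one copy to two. -/
lemma star_doubleVec_dotProduct (ψ φ : K → ℂ) :
    star (doubleVec ψ) ⬝ᵥ doubleVec φ = (star ψ ⬝ᵥ φ) ^ 2 := by
  refine (star_prod_dotProduct (fun w : K × K => ψ w.1 * ψ w.2)
    (fun w : K × K => φ w.1 * φ w.2) blank blank).trans ?_
  rw [star_prod_dotProduct, star_blank_dotProduct]
  ring

variable {R : Type} [Fintype R] [DecidableEq R]

lemma submatrix_isometry {L : Type} [Fintype L] [DecidableEq L] (e : R ≃ L) {U : Matrix L L ℂ}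
    (h : Uᴴ * U = 1) : (U.submatrix e e)ᴴ * U.submatrix e e = 1 := by
  rw [Matrix.conjTranspose_submatrix, Matrix.submatrix_mul_equiv, h]
  simp

lemma submatrix_mulVec_comp {L : Type} [Fintype L] (e : R ≃ L) (U : Matrix L L ℂ) (v : L → ℂ) :
    U.submatrix e e *ᵥ (v ∘ e) = (U *ᵥ v) ∘ e := by
  rw [Matrix.submatrix_mulVec_equiv]
  congr 2
  ext i
  simp

lemma star_comp_dotProduct_comp {L : Type} [Fintype L] (e : R ≃ L) (u v : L → ℂ) :
    star (u ∘ e) ⬝ᵥ (v ∘ e) = star u ⬝ᵥ v :=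
  e.sum_comp fun i => star (u i) * v i

end Double

/-! ### The search protocol and its output. -/

variable {M N q : ℕ} {ι : Type}

/-- One of the two copies holds a common element. -/
def found (y : Fin N → Bool) (w : Cell M N × Cell M N) : Bool := good y w.1 || good y w.2

/-- Bob adds the result to the result bit and to his private qubit. -/
def finalPerm (e : Reg q ≃ (Cell M N × Cell M N) × Bool) (y : Fin N → Bool) :
    Equiv.Perm (Reg 1 × Reg q) :=
  Function.Involutive.toPerm (fun z =>
    (if found y (e z.2).1 then fun i => (z.1 i).rev else z.1,
      e.symm ((e z.2).1, xor (e z.2).2 (found y (e z.2).1)))) fun z => by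
    by_cases h : found y (e z.2).1 <;> simp [h]

/-- The search protocol. -/
def scheme [NeZero M] [NeZero N] (e : Reg q ≃ (Cell M N × Cell M N) × Bool) {ω : ℂ}
    (hω : star ω * ω = 1) (v : ι → Fin N → Bool) : PingPong ι ι Bool q where
  turns := M - 1
  init x := doubleVec (initVec M (v x)) ∘ e
  init_unit x := by
    rw [star_comp_dotProduct_comp, star_doubleVec_dotProduct, initVec_unit, one_pow]
  opAl k x := (doubleMatrix (alMatrix M k (v x))).submatrix e e
  opAl_isometry k x := submatrix_isometry e (doubleMatrix_isometry (alMatrix_isometry k (v x)))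
  opBob y := (doubleMatrix (bobMatrix M ω (v y))).submatrix e e
  opBob_isometry y :=
    submatrix_isometry e (doubleMatrix_isometry (bobMatrix_isometry hω (v y)))
  final y := finalPerm e (v y)
  outAl m := !(e m).2
  outBob b := decide (b 0 = 0)

section Scheme

variable [NeZero M] [NeZero N] (e : Reg q ≃ (Cell M N × Cell M N) × Bool) {ω : ℂ}
    (hω : star ω * ω = 1) (v : ι → Fin N → Bool)

lemma opBob_mulVec (y : ι) (ψ : Cell M N → ℂ) :
    (scheme e hω v).opBob y *ᵥ (doubleVec ψ ∘ e) =
      doubleVec (bobMatrix M ω (v y) *ᵥ ψ) ∘ e := by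
  change (doubleMatrix (bobMatrix M ω (v y))).submatrix e e *ᵥ _ = _
  rw [submatrix_mulVec_comp, doubleMatrix_mulVec]

lemma msg_scheme (x y : ι) (k : ℕ) :
    (scheme e hω v).msg x y k = doubleVec (vec M ω (v x) (v y) k) ∘ e := by
  induction k with
  | zero => rfl
  | succ k ih =>
    rw [PingPong.msg, ih, opBob_mulVec, vec]
    change (doubleMatrix (alMatrix M k (v x))).submatrix e e *ᵥ _ = _
    rw [submatrix_mulVec_comp, doubleMatrix_mulVec]

lemma sum_normSq_vec (x y : Fin N → Bool) (k : ℕ) (hω : star ω * ω = 1) :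
    ∑ s, Complex.normSq (vec M ω x y k s) = 1 := by
  have h := congrArg Complex.re (vec_unit (M := M) hω x y k)
  simpa [dotProduct, Complex.normSq_apply] using h

lemma sum_not_good (x y : Fin N → Bool) (k : ℕ) (hω : star ω * ω = 1) :
    ∑ s : Cell M N, (if good y s then 0 else Complex.normSq (vec M ω x y k s)) =
      1 - success M ω x y k := by
  rw [← sum_normSq_vec (M := M) x y k hω, success, ← Finset.sum_sub_distrib]
  refine Finset.sum_congr rfl fun s _ => ?_
  split_ifs <;> simp

/-- Both players read the same bit: Bob writes it into his private qubit and into the blank result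
bit of the message. So they always agree, and only the two measured cells matter. -/
lemma outputProb_scheme (x y : ι) (z : Bool) :
    (scheme e hω v).protocol.outputProb x y z = ∑ s : Cell M N, ∑ t : Cell M N,
      if (!(good (v y) s || good (v y) t)) = z then
        Complex.normSq (vec M ω (v x) (v y) (M - 1) s) *
          Complex.normSq (vec M ω (v x) (v y) (M - 1) t) else 0 := by
  rw [PingPong.outputProb_protocol, msg_scheme, ← Equiv.sum_comp e.symm, Fintype.sum_prod_type,
    Fintype.sum_prod_type]
  refine Finset.sum_congr rfl fun s _ => Finset.sum_congr rfl fun t _ => ?_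
  rw [Fintype.sum_bool]
  have h1 : ∀ r, Complex.normSq ((doubleVec (vec M ω (v x) (v y) (scheme e hω v).turns) ∘ e)
      (e.symm ((s, t), r))) = if r then 0 else
        Complex.normSq (vec M ω (v x) (v y) (M - 1) s) *
          Complex.normSq (vec M ω (v x) (v y) (M - 1) t) := by
    intro r
    change Complex.normSq (doubleVec (vec M ω (v x) (v y) (M - 1)) (e (e.symm ((s, t), r)))) = _
    rw [Equiv.apply_symm_apply]
    cases r <;> simp [doubleVec, blank]
  have h2 : (scheme e hω v).outAl ((scheme e hω v).final y (0, e.symm ((s, t), false))).2 =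
      !(good (v y) s || good (v y) t) := by
    change (!(e (e.symm ((e (e.symm ((s, t), false))).1, xor (e (e.symm ((s, t), false))).2
      (found (v y) (e (e.symm ((s, t), false))).1)))).2) = _
    simp only [Equiv.apply_symm_apply, found, Bool.false_xor]
  have h3 : (scheme e hω v).outBob ((scheme e hω v).final y (0, e.symm ((s, t), false))).1 =
      !(good (v y) s || good (v y) t) := by
    change decide ((if found (v y) (e (e.symm ((s, t), false))).1 then
      fun i => ((0 : Reg 1) i).rev else 0) 0 = 0) = _
    simp only [Equiv.apply_symm_apply, found]
    cases good (v y) s || good (v y) t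
    · simp
    · simp only [if_true, Bool.not_true, decide_eq_false_iff_not]
      change ¬ (Fin.rev (0 : Fin 2) = 0)
      decide
  rw [h1, h1, h2, h3]
  simp

lemma outputProb_scheme_true (x y : ι) :
    (scheme e hω v).protocol.outputProb x y true =
      (1 - success M ω (v x) (v y) (M - 1)) ^ 2 := by
  rw [outputProb_scheme, sq, ← sum_not_good _ _ _ hω, Finset.sum_mul_sum]
  refine Finset.sum_congr rfl fun s _ => Finset.sum_congr rfl fun t _ => ?_
  cases good (v y) s <;> cases good (v y) t <;> simp

lemma outputProb_scheme_false (x y : ι) :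
    (scheme e hω v).protocol.outputProb x y false =
      1 - (1 - success M ω (v x) (v y) (M - 1)) ^ 2 := by
  rw [← outputProb_scheme_true e hω v, outputProb_scheme, outputProb_scheme, eq_sub_iff_add_eq,
    ← Finset.sum_add_distrib]
  have : (1 : ℝ) = (∑ s : Cell M N, Complex.normSq (vec M ω (v x) (v y) (M - 1) s)) *
      ∑ s : Cell M N, Complex.normSq (vec M ω (v x) (v y) (M - 1) s) := by
    rw [sum_normSq_vec _ _ _ hω, one_mul]
  rw [this, Finset.sum_mul_sum]
  refine Finset.sum_congr rfl fun s _ => ?_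
  rw [← Finset.sum_add_distrib]
  refine Finset.sum_congr rfl fun t _ => ?_
  cases good (v y) s || good (v y) t <;> simp

/-- The flag always equals `x i`, so a good cell with nonzero amplitude would be a common element.
-/
lemma success_eq_zero {x y : Fin N → Bool} (h : common x y = 0) (k : ℕ) :
    success M ω x y k = 0 := by
  refine Finset.sum_eq_zero fun s _ => ?_
  split_ifs with hs
  · rw [vec_eq]
    split_ifs with hx
    · exfalso
      rw [common, Finset.card_eq_zero, Finset.filter_eq_empty_iff] at h
      refine h (Finset.mem_univ s.1.1) ?_
      rw [← hx]
      exact hs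
    · simp
  · rfl

lemma privacyLossLE_scheme [Fintype ι] [DecidableEq ι] [Nonempty ι] (f : ι → ι → Bool)
    (hneB : ∀ k < M - 1, ∀ a a' b, star (vec M ω (v a) (v b) k) ⬝ᵥ vec M ω (v a') (v b) k ≠ 0)
    (hneA : ∀ k < M - 1, ∀ a b b', star (bobMatrix M ω (v b) *ᵥ vec M ω (v a) (v b) k) ⬝ᵥ
        (bobMatrix M ω (v b') *ᵥ vec M ω (v a) (v b') k) ≠ 0) :
    (scheme e hω v).protocol.PrivacyLossLE f q := by
  refine PingPong.privacyLossLE _ f (fun k hk x x' y => ?_) (fun k hk x y y' => ?_)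
  · rw [msg_scheme, msg_scheme, star_comp_dotProduct_comp, star_doubleVec_dotProduct]
    exact pow_ne_zero 2 (hneB k hk x x' y)
  · rw [msg_scheme, msg_scheme, opBob_mulVec, opBob_mulVec, star_comp_dotProduct_comp,
      star_doubleVec_dotProduct]
    exact pow_ne_zero 2 (hneA k hk x y y')

end Scheme

/-! ### Disjointness, and the choice of parameters. -/

/-- The characteristic function of a set, extended by zero. -/
def indicator {n : ℕ} (N : ℕ) (x : Finset (Fin n)) : Fin N → Bool :=
  fun i => decide (∃ h : i.1 < n, (⟨i, h⟩ : Fin n) ∈ x)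

lemma common_indicator_le {n : ℕ} (x y : Finset (Fin n)) :
    common (indicator N x) (indicator N y) ≤ n := by
  have : (Finset.univ.filter fun i => (indicator N x i && indicator N y i) = true).card ≤
      (Finset.range n).card := by
    refine Finset.card_le_card_of_injOn (fun i => i.1) (fun i hi => ?_) Fin.val_injective.injOn
    simp only [Finset.coe_filter, Set.mem_ofPred_eq, Bool.and_eq_true, indicator,
      decide_eq_true_eq] at hi
    obtain ⟨-, ⟨h, -⟩, -⟩ := hi
    simpa using h
  simpa [common] using this

lemma common_indicator_pos_iff {n : ℕ} (hN : n ≤ N) (x y : Finset (Fin n)) :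
    0 < common (indicator N x) (indicator N y) ↔ ¬ Disjoint x y := by
  rw [common, Finset.card_pos, Finset.not_disjoint_iff]
  constructor
  · rintro ⟨i, hi⟩
    simp only [Finset.mem_filter, Bool.and_eq_true, indicator, decide_eq_true_eq] at hi
    obtain ⟨-, ⟨h, hx⟩, ⟨h', hy⟩⟩ := hi
    exact ⟨⟨i, h⟩, hx, hy⟩
  · rintro ⟨a, hx, hy⟩
    refine ⟨⟨a, a.2.trans_le hN⟩, ?_⟩
    simp only [Finset.mem_filter, Finset.mem_univ, true_and, Bool.and_eq_true, indicator,
      decide_eq_true_eq]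
    exact ⟨⟨a.2, hx⟩, ⟨a.2, hy⟩⟩

/-- A protocol for disjointness, when the index set has `4 ^ l` elements. -/
theorem exists_protocol (n l : ℕ) (hn : 0 < n) (hl : 2 * n ≤ 2 ^ (2 * l)) :
    ∃ P : Protocol (Finset (Fin n)) (Finset (Fin n)) Bool,
      P.Computes (disj n) (1 / 3) ∧
      P.communication = 2 ^ (l + 2) * (6 * l + 7 + (6 * l + 7)) ∧
      P.PrivacyLossLE (disj n) ((6 * l + 7 : ℕ) : ℝ) := by
  have hM0 : 0 < 2 ^ (l + 2) := by positivity
  have hN0 : 0 < 2 ^ (2 * l) := by positivity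
  set M := 2 ^ (l + 2) with hM
  set N := 2 ^ (2 * l) with hN
  have : NeZero M := ⟨hM0.ne'⟩
  have : NeZero N := ⟨hN0.ne'⟩
  have hMN : M ^ 2 = 16 * N := by
    rw [hM, hN, ← pow_mul, show (16 : ℕ) = 2 ^ 4 by norm_num, ← pow_add]
    congr 1
    ring
  obtain ⟨ω, hω, hB, hA, hs⟩ := exists_phase hMN (indicator (n := n) N)
    -- The padding index `n < N` lies in no input set, so the messages of any two inputs overlap
    -- there.
    (i₀ := ⟨n, by omega⟩) (fun a => by simp [indicator])
    (fun a b => (Nat.mul_le_mul_left 2 (common_indicator_le a b)).trans hl)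
    (T := M - 1) (by omega)
  -- One copy needs `2l` qubits for the index, `1` for the flag and `l + 2` for the counter; two
  -- copies and the result bit give `2 (3l + 3) + 1`.
  have hcard : Fintype.card (Reg (6 * l + 7)) =
      Fintype.card ((Cell M N × Cell M N) × Bool) := by
    rw [PingPong.card_reg]
    simp only [Fintype.card_prod, Fintype.card_fin, Fintype.card_bool]
    rw [hM, hN]
    ring
  have e := Fintype.equivOfCardEq hcard
  refine ⟨(scheme e hω (indicator N)).protocol, fun x y => ?_, ?_, ?_⟩
  · by_cases hxy : Disjoint x y
    · have h0 : common (indicator N x) (indicator N y) = 0 := by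
        by_contra h
        exact (common_indicator_pos_iff (by omega) x y).1 (Nat.pos_of_ne_zero h) hxy
      rw [show disj n x y = true by simpa [disj] using hxy, outputProb_scheme_true,
        success_eq_zero h0]
      norm_num
    · have h1 := hs x y ((common_indicator_pos_iff (by omega) x y).2 hxy)
      rw [show disj n x y = false by simpa [disj] using hxy, outputProb_scheme_false]
      have h2 : success M ω (indicator N x) (indicator N y) (M - 1) ≤ 1 := by
        have h3 : 0 ≤ 1 - success M ω (indicator N x) (indicator N y) (M - 1) := by
          rw [← sum_not_good _ _ _ hω]
          refine Finset.sum_nonneg fun s _ => ?_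
          split_ifs
          · exact le_rfl
          · exact Complex.normSq_nonneg _
        linarith
      -- `(1 - 3/7)² = 16/49 < 1/3`; `success ≤ 1` is needed to square the inequality.
      nlinarith
  · rw [PingPong.communication_protocol]
    change (M - 1 + 1) * _ = _
    rw [Nat.sub_add_cancel hM0]
  · exact privacyLossLE_scheme e hω (indicator N) (disj n) hB hA

end Grover

end QPrivacy

end

theorem theorem1 :
    ∃ C : ℝ, ∀ n : ℕ, 2 ≤ n →
      ∃ P : QPrivacy.Protocol (Finset (Fin n)) (Finset (Fin n)) Bool,
        P.Computes (QPrivacy.disj n) (1 / 3) ∧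
        (P.communication : ℝ) ≤ C * (Real.sqrt n * Real.logb 2 n) ∧
        P.PrivacyLossLE (QPrivacy.disj n) (C * Real.logb 2 n ^ 2) := by
  -- `M ≤ 16 √n` rounds of `2q` qubits with `q = 6l + 7 ≤ 3L + 19 ≤ 22 L` give `16 * 44 = 704`.
  refine ⟨704, fun n hn => ?_⟩
  set a := Nat.log 2 n with ha
  have h1 : 2 ^ a ≤ n := Nat.pow_log_le_self 2 (by omega)
  have h2 : n < 2 ^ (a + 1) := Nat.lt_pow_succ_log_self (by norm_num) n
  set l := a / 2 + 2 with hl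
  have h3 : 2 * n ≤ 2 ^ (2 * l) := by
    have : 2 ^ (a + 2) ≤ 2 ^ (2 * l) := Nat.pow_le_pow_right (by norm_num) (by omega)
    have e : 2 ^ (a + 2) = 2 * 2 ^ (a + 1) := by ring
    omega
  obtain ⟨P, hP, hc, hpl⟩ := QPrivacy.Grover.exists_protocol n l (by omega) h3
  set L := Real.logb 2 n with hL
  have hn0 : (0 : ℝ) < n := by positivity
  have hL1 : 1 ≤ L := by
    rw [hL, Real.le_logb_iff_rpow_le (by norm_num) hn0, Real.rpow_one]
    exact_mod_cast hn
  have haL : (a : ℝ) ≤ L := by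
    rw [hL, Real.le_logb_iff_rpow_le (by norm_num) hn0, Real.rpow_natCast]
    exact_mod_cast h1
  have hlL : (l : ℝ) ≤ L / 2 + 2 := by
    have : ((a / 2 : ℕ) : ℝ) ≤ (a : ℝ) / 2 := Nat.cast_div_le
    rw [hl]
    push_cast
    linarith
  have hq : ((6 * l + 7 : ℕ) : ℝ) ≤ 22 * L := by
    push_cast
    linarith
  have hM : ((2 ^ (l + 2) : ℕ) : ℝ) ≤ 16 * Real.sqrt n := by
    have h4 : (2 : ℝ) ^ (a / 2) ≤ Real.sqrt n := by
      refine Real.le_sqrt_of_sq_le ?_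
      rw [← pow_mul]
      have h5 : 2 ^ (a / 2 * 2) ≤ n :=
        (Nat.pow_le_pow_right (by norm_num) (Nat.div_mul_le_self a 2)).trans h1
      exact_mod_cast h5
    rw [hl]
    push_cast
    rw [pow_add, pow_add]
    linarith
  refine ⟨P, hP, ?_, fun μ hμ => ?_⟩
  · rw [hc, Nat.cast_mul, Nat.cast_add]
    calc _ ≤ (16 * Real.sqrt n) * (22 * L + 22 * L) :=
          mul_le_mul hM (add_le_add hq hq) (by positivity) (by positivity)
      _ = 704 * (Real.sqrt n * L) := by ring
  · have hle : ((6 * l + 7 : ℕ) : ℝ) ≤ 704 * L ^ 2 := by nlinarith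
    have hpl := hpl μ hμ
    exact ⟨fun A k => ⟨fun h h' => ((hpl.1 A k).1 h h').trans hle,
        fun h h' => ((hpl.1 A k).2 h h').trans hle⟩,
      fun B k => ⟨fun h h' => ((hpl.2 B k).1 h h').trans hle,
        fun h h' => ((hpl.2 B k).2 h h').trans hle⟩⟩
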